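/- Let $d,n,k,\ell\ge 1$ be integers with $n=k\ell$, let $\delta\in(0,1/2)$ and $\theta\in\mathbf R^d$, and let $$Y_i=\eta_i\theta+\xi_i,\qquad i=1,\dots,n,$$ where $(\eta_i)$ is a homogeneous symmetric Markov chain on $\{-1,1\}$ with flip probability $\delta$ ($\eta_1$ is Rademacher and, given the past, $\eta_{i+1}=-\eta_i$ with probability $\delta$ and $\eta_{i+1}=\eta_i$ with probability $1-\delta$), and $\xi_1,\dots,\xi_n$ are i.i.d. random vectors in $\mathbf R^d$, independent of $\eta$, which are isotropic ($\mathbf E[\xi_i\xi_i^\top]=\mathbf I_d$) and $1$-sub-Gaussian ($\mathbf E\,e^{\langle v,\xi_i\rangle}\le e^{\|v\|^2/2}$ for all $v\in\mathbf R^d$). Split $\{1,\dots,n\}$ into $\ell$ consecutive buckets $I_1,\dots,I_\ell$ of length $k$ and put $$\tilde Y_i=\frac1k\sum_{j\in I_i}Y_j,\qquad \bar\eta_i=\frac1k\sum_{j\in I_i}\eta_j,\qquad \bar\eta=(\bar\eta_1,\dots,\bar\eta_\ell),\qquad \hat\Sigma=\frac1\ell\tilde Y\tilde Y^\top,$$ where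 $\tilde Y\in\mathbf R^{d\times\ell}$ has columns $\tilde Y_1,\dots,\tilde Y_\ell$. Let $\lambda_{\max}(\hat\Sigma)$ be the largest eigenvalue of $\hat\Sigma$ and $v_{\max}(\hat\Sigma)$ a corresponding unit eigenvector (any choice), and define $$\hat\theta(\ell)=\sqrt{\frac{\ell}{\mathbf E\|\bar\eta\|^2}\Big(\lambda_{\max}(\hat\Sigma)-\frac1k\Big)_+}\;v_{\max}(\hat\Sigma),\qquad \ell(\tilde\theta,\theta)=\min\{\|\tilde\theta-\theta\|,\|\tilde\theta+\theta\|\}.$$ There are absolute constants $c_0,c_1,C>0$ such that, for all such $d,n,k,\ell,\delta,\theta$ and all such distributions of the noise, the following hold. (i) If $0<\|\theta\|^2\le1$, then with probability at least $1-c_1e^{-c_0d}$ $$\ell(\hat\theta(\ell),\theta)\le C\,\frac{\ell}{\mathbf E\|\bar\eta\|^2}\left(\sqrt{\frac d\ell}\,\|\theta\|+\sqrt{\frac dn}+\frac1{\|\theta\|}\Big(\sqrt{\frac d{kn}}+\frac dn\Big)\right).$$ (ii) If $\|\theta\|^2\ge1$ and $\ell=n$ (so $k=1$), then with probability at least $1-c_1e^{-c_0d}$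 $$\ell(\hat\theta(n),\theta)\le C\left(\sqrt{\frac dn}+\frac dn\right).$$ -/

import Mathlib

open MeasureTheory ProbabilityTheory

noncomputable section

namespace HiddenMarkovMixture

variable {Ω : Type*} [MeasurableSpace Ω]

/-- `η 0, …, η (n - 1)` is a homogeneous binary symmetric Markov chain with flip probability `δ`:
the first sign is Rademacher and, given the whole past up to time `i`, the next sign is the
opposite of `η i` with probability `δ` (and hence equal to it with probability `1 - δ`). -/
structure IsSymmetricSignChain (μ : Measure Ω) (δ : ℝ) {n : ℕ} (η : Fin n → Ω → ℝ) : Prop where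
  measurable : ∀ i, Measurable (η i)
  sign : ∀ i ω, η i ω = 1 ∨ η i ω = -1
  initial : ∀ i : Fin n, (i : ℕ) = 0 →
    μ.real {ω | η i ω = 1} = 1 / 2 ∧ μ.real {ω | η i ω = -1} = 1 / 2
  transition : ∀ i j : Fin n, (j : ℕ) = (i : ℕ) + 1 → ∀ s : Fin n → ℝ,
    μ.real {ω | (∀ m ≤ i, η m ω = s m) ∧ η j ω = -η i ω} =
      δ * μ.real {ω | ∀ m ≤ i, η m ω = s m}

/-- A random vector is 1-(sub)Gaussian: `E exp ⟨v, ξ⟩ ≤ exp (‖v‖² / 2)` for every `v`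
(the expectation being finite). -/
def IsSubGaussianVector {d : ℕ} (μ : Measure Ω) (ξ : Ω → EuclideanSpace ℝ (Fin d)) : Prop :=
  ∀ v : EuclideanSpace ℝ (Fin d),
    Integrable (fun ω => Real.exp (inner ℝ v (ξ ω))) μ ∧
      ∫ ω, Real.exp (inner ℝ v (ξ ω)) ∂μ ≤ Real.exp (‖v‖ ^ 2 / 2)

/-- A random vector is isotropic: `E[ξ ξᵀ]` is the identity matrix. -/
def IsIsotropic {d : ℕ} (μ : Measure Ω) (ξ : Ω → EuclideanSpace ℝ (Fin d)) : Prop :=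
  ∀ a b : Fin d, ∫ ω, ξ ω a * ξ ω b ∂μ = if a = b then 1 else 0

/-- I.i.d. isotropic 1-(sub)Gaussian noise vectors. -/
structure IsNoise {d n : ℕ} (μ : Measure Ω) (ξ : Fin n → Ω → EuclideanSpace ℝ (Fin d)) :
    Prop where
  measurable : ∀ i, Measurable (ξ i)
  indep : iIndepFun ξ μ
  identDistrib : ∀ i j, IdentDistrib (ξ i) (ξ j) μ μ
  isotropic : ∀ i, IsIsotropic μ (ξ i)
  subGaussian : ∀ i, IsSubGaussianVector μ (ξ i)

/-- The hidden Markov sub-Gaussian mixture model `Y i = η i • θ + ξ i`, with the sign chain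
independent of the noise. -/
structure IsModel {d n : ℕ} (μ : Measure Ω) (δ : ℝ) (θ : EuclideanSpace ℝ (Fin d))
    (η : Fin n → Ω → ℝ) (ξ Y : Fin n → Ω → EuclideanSpace ℝ (Fin d)) : Prop where
  chain : IsSymmetricSignChain μ δ η
  noise : IsNoise μ ξ
  indep : IndepFun (fun ω i => η i ω) (fun ω i => ξ i ω) μ
  obs : ∀ i ω, Y i ω = η i ω • θ + ξ i ω

/-- The `i`-th bucket of `k` consecutive indices: those `j` with `i * k ≤ j < (i + 1) * k`. -/
def bucket (n k : ℕ) {l : ℕ} (i : Fin l) : Finset (Fin n) :=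
  {j | (i : ℕ) * k ≤ (j : ℕ) ∧ (j : ℕ) < ((i : ℕ) + 1) * k}

/-- The mean over the `i`-th bucket (of length `k`). -/
def bucketMean {E : Type*} [AddCommGroup E] [Module ℝ E] {n : ℕ} (k : ℕ) {l : ℕ}
    (x : Fin n → E) (i : Fin l) : E :=
  (1 / (k : ℝ)) • ∑ j ∈ bucket n k i, x j

/-- `E ‖η̄‖²`, where `η̄` is the vector of the `l` bucket means of the signs. -/
def expectedEnergy (μ : Measure Ω) {n : ℕ} (k l : ℕ) (η : Fin n → Ω → ℝ) : ℝ :=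
  ∫ ω, ∑ i : Fin l, (bucketMean k (fun j => η j ω) i) ^ 2 ∂μ

/-- The `d × l` matrix whose columns are the bucket means of the data. -/
def bucketMatrix {d n : ℕ} (k l : ℕ) (y : Fin n → EuclideanSpace ℝ (Fin d)) :
    Matrix (Fin d) (Fin l) ℝ :=
  Matrix.of fun a i => bucketMean k y i a

/-- The matrix `Σ̂ = (1 / l) Ỹ Ỹᵀ`. -/
def sampleCov {d n : ℕ} (k l : ℕ) (y : Fin n → EuclideanSpace ℝ (Fin d)) :
    Matrix (Fin d) (Fin d) ℝ :=
  (1 / (l : ℝ)) • (bucketMatrix k l y * (bucketMatrix k l y).transpose)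

/-- The largest (real) eigenvalue. -/
def lambdaMax {d : ℕ} (A : Matrix (Fin d) (Fin d) ℝ) : ℝ :=
  sSup (spectrum ℝ A)

/-- `vmax` assigns to every symmetric matrix a unit eigenvector for its largest eigenvalue. -/
def IsTopEigenvectorMap {d : ℕ}
    (vmax : Matrix (Fin d) (Fin d) ℝ → EuclideanSpace ℝ (Fin d)) : Prop :=
  ∀ A : Matrix (Fin d) (Fin d) ℝ, A.IsSymm →
    ‖vmax A‖ = 1 ∧ Matrix.toEuclideanLin A (vmax A) = lambdaMax A • vmax A

/-- The spectral estimator with `l` buckets of length `k`, as a function of the data `y`;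
`m` is the (known) value of `E ‖η̄‖²`. -/
def thetaHat {d n : ℕ} (vmax : Matrix (Fin d) (Fin d) ℝ → EuclideanSpace ℝ (Fin d))
    (k l : ℕ) (m : ℝ) (y : Fin n → EuclideanSpace ℝ (Fin d)) : EuclideanSpace ℝ (Fin d) :=
  √((l : ℝ) / m * max (lambdaMax (sampleCov k l y) - 1 / (k : ℝ)) 0) • vmax (sampleCov k l y)

/-- The sign-invariant loss. -/
def loss {d : ℕ} (a b : EuclideanSpace ℝ (Fin d)) : ℝ :=
  min ‖a - b‖ ‖a + b‖

end HiddenMarkovMixture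

end

open scoped RealInnerProductSpace

/-
The matrix `Σ̂ - I / k` is close to the rank-one operator `(m / l) θ θᵀ` with `m = E ‖η̄‖²`, and an
approximate top eigenpair of such an operator recovers `θ` up to sign. Three deviations have to be
controlled. The energy `‖η̄‖²` is the sum of the squares `η̄ᵢ²`, which depend only on the flips
inside disjoint buckets; the flips are independent, so Hoeffding's inequality applies although the
signs themselves are dependent. The cross term between signal and noise is sub-Gaussian given the
signs, and the empirical covariance of the noise satisfies a Bernstein inequality in every pair of
directions; a union bound over at most `5 ^ d` directions turns both into norm bounds.
-/

namespace HiddenMarkovMixture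

section Perturbation

variable {V : Type*} [NormedAddCommGroup V] [InnerProductSpace ℝ V] {θ v : V} {s κ ε : ℝ}

lemma abs_sub_mul_inner_sq_le (hv : ‖v‖ = 1) (hε : ‖κ • v - (s * ⟪θ, v⟫) • θ‖ ≤ ε) :
    |κ - s * ⟪θ, v⟫ ^ 2| ≤ ε := by
  have h := abs_real_inner_le_norm (κ • v - (s * ⟪θ, v⟫) • θ) v
  rw [inner_sub_left, real_inner_smul_left, real_inner_smul_left, real_inner_self_eq_norm_sq, hv,
    one_pow, mul_one, mul_one, mul_assoc, ← sq] at h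
  exact h.trans hε

lemma mul_sqrt_max_sq (hs : 0 < s) : s * √(1 / s * max κ 0) ^ 2 = max κ 0 := by
  rw [Real.sq_sqrt (by positivity)]
  field_simp

lemma norm_sqrt_smul_sub_le_of_weak (hs : 0 < s) (hv : ‖v‖ = 1)
    (hκ : κ ≤ s * ‖θ‖ ^ 2 + ε) (hθ : s * ‖θ‖ ^ 2 ≤ 4 * ε) :
    ‖√(1 / s * max κ 0) • v - θ‖ * (s * ‖θ‖) ≤ 10 * ε := by
  set ρ := √(1 / s * max κ 0)
  have hρ : 0 ≤ ρ := Real.sqrt_nonneg _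
  have hρ_sq : s * ρ ^ 2 ≤ s * ‖θ‖ ^ 2 + ε := by
    have hsθ : 0 ≤ s * ‖θ‖ ^ 2 := by positivity
    rw [mul_sqrt_max_sq hs]
    exact max_le hκ (by linarith)
  have hρθ : s * ρ * ‖θ‖ ≤ 6 * ε := by nlinarith [mul_nonneg hs.le (sq_nonneg (ρ - ‖θ‖))]
  have htri : ‖ρ • v - θ‖ ≤ ρ + ‖θ‖ := by
    simpa [norm_smul, hv, abs_of_nonneg hρ] using norm_sub_le (ρ • v) θ
  calc ‖ρ • v - θ‖ * (s * ‖θ‖) ≤ (ρ + ‖θ‖) * (s * ‖θ‖) := by gcongr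
    _ = s * ρ * ‖θ‖ + s * ‖θ‖ ^ 2 := by ring
    _ ≤ 10 * ε := by linarith

lemma mul_norm_smul_sub_le {ρ : ℝ} (hs : 0 ≤ s) (hv : ‖v‖ = 1) (hθv : 0 ≤ ⟪θ, v⟫) (hρ : 0 ≤ ρ)
    (hε : ‖(s * ρ ^ 2) • v - (s * ⟪θ, v⟫) • θ‖ ≤ ε) :
    s * ⟪θ, v⟫ * ‖ρ • v - θ‖ ≤ 2 * ε := by
  have hκ := abs_sub_mul_inner_sq_le hv hε
  set a := ⟪θ, v⟫
  have hρa : s * (ρ * |ρ - a|) ≤ ε := calc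
    s * (ρ * |ρ - a|) ≤ s * ((ρ + a) * |ρ - a|) := by gcongr; linarith
    _ = |s * ρ ^ 2 - s * a ^ 2| := by
      rw [← abs_of_nonneg (add_nonneg hρ hθv), ← abs_mul, ← abs_of_nonneg hs, ← abs_mul,
        abs_of_nonneg hs]
      ring_nf
    _ ≤ ε := hκ
  calc s * a * ‖ρ • v - θ‖ = ‖(s * a) • (ρ • v - θ)‖ := by
        rw [norm_smul, Real.norm_of_nonneg (by positivity)]
    _ = ‖((s * ρ ^ 2) • v - (s * a) • θ) - (s * (ρ * (ρ - a))) • v‖ := by congr 1; module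
    _ ≤ ‖(s * ρ ^ 2) • v - (s * a) • θ‖ + s * (ρ * |ρ - a|) := by
        refine (norm_sub_le _ _).trans_eq ?_
        simp only [norm_smul, hv, mul_one, norm_mul, Real.norm_eq_abs, abs_of_nonneg hs,
          abs_of_nonneg hρ]
    _ ≤ 2 * ε := by linarith

lemma norm_sqrt_smul_sub_le_of_strong (hs : 0 < s) (hv : ‖v‖ = 1) (hθv : 0 ≤ ⟪θ, v⟫)
    (hε : ‖κ • v - (s * ⟪θ, v⟫) • θ‖ ≤ ε) (hκ : s * ‖θ‖ ^ 2 - ε ≤ κ)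
    (hθ : 4 * ε ≤ s * ‖θ‖ ^ 2) :
    ‖√(1 / s * max κ 0) • v - θ‖ * (s * ‖θ‖) ≤ 4 * ε := by
  have hε₀ : 0 ≤ ε := (norm_nonneg _).trans hε
  have hκ_sub := (abs_le.1 (abs_sub_mul_inner_sq_le hv hε)).2
  have hκρ : s * √(1 / s * max κ 0) ^ 2 = κ := by
    rw [mul_sqrt_max_sq hs, max_eq_left (by linarith)]
  have hcorr : ‖θ‖ ≤ 2 * ⟪θ, v⟫ := by
    have : s * ‖θ‖ ^ 2 ≤ s * (2 * ⟪θ, v⟫ ^ 2) := by linarith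
    nlinarith [le_of_mul_le_mul_left this hs, norm_nonneg θ]
  have hmain := mul_norm_smul_sub_le hs.le hv hθv (Real.sqrt_nonneg (1 / s * max κ 0))
    (hκρ.symm ▸ hε)
  calc ‖√(1 / s * max κ 0) • v - θ‖ * (s * ‖θ‖)
      ≤ ‖√(1 / s * max κ 0) • v - θ‖ * (s * (2 * ⟪θ, v⟫)) := by gcongr
    _ = 2 * (s * ⟪θ, v⟫ * ‖√(1 / s * max κ 0) • v - θ‖) := by ring
    _ ≤ 4 * ε := by linarith

lemma min_norm_sub_norm_add_le (hs : 0 < s) (hθ : θ ≠ 0) (hv : ‖v‖ = 1)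
    (hε : ‖κ • v - (s * ⟪θ, v⟫) • θ‖ ≤ ε) (hκ : s * ‖θ‖ ^ 2 - ε ≤ κ) :
    min ‖√(1 / s * max κ 0) • v - θ‖ ‖√(1 / s * max κ 0) • v + θ‖ ≤ 10 * ε / (s * ‖θ‖) := by
  wlog hθv : 0 ≤ ⟪θ, v⟫ generalizing θ
  · have h := @this (-θ) (neg_ne_zero.2 hθ) (by simpa [inner_neg_left] using hε)
      (by simpa using hκ) (by rw [inner_neg_left]; linarith)
    rwa [norm_neg, sub_neg_eq_add, ← sub_eq_add_neg, min_comm] at h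
  refine (min_le_left _ _).trans ?_
  have hε₀ : 0 ≤ ε := (norm_nonneg _).trans hε
  rw [le_div_iff₀ (mul_pos hs (norm_pos_iff.2 hθ))]
  rcases le_total (s * ‖θ‖ ^ 2) (4 * ε) with hweak | hstrong
  · have hθv_le : ⟪θ, v⟫ ≤ ‖θ‖ := by simpa [hv] using real_inner_le_norm θ v
    have hκ_sub := (abs_le.1 (abs_sub_mul_inner_sq_le hv hε)).2
    have : s * ⟪θ, v⟫ ^ 2 ≤ s * ‖θ‖ ^ 2 := by gcongr
    exact norm_sqrt_smul_sub_le_of_weak hs hv (by linarith) hweak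
  · linarith [norm_sqrt_smul_sub_le_of_strong hs hv hθv hε hκ hstrong]

end Perturbation

section LambdaMax

variable {d : ℕ} {A : Matrix (Fin d) (Fin d) ℝ}

lemma posSemidef_lambdaMax_sub (hA : A.IsSymm) :
    (algebraMap ℝ (Matrix (Fin d) (Fin d) ℝ) (lambdaMax A) - A).PosSemidef := by
  have hA' : A.IsHermitian := by
    rwa [Matrix.IsHermitian, Matrix.conjTranspose_eq_transpose_of_trivial]
  rw [Matrix.posSemidef_iff_isHermitian_and_spectrum_nonneg]
  refine ⟨.sub ?_ hA', fun μ hμ => ?_⟩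
  · rw [Matrix.algebraMap_eq_diagonal]
    exact Matrix.isHermitian_diagonal _
  · rw [← spectrum.singleton_sub_eq] at hμ
    obtain ⟨_, rfl, ν, hν, rfl⟩ := hμ
    exact sub_nonneg.2 (le_csSup Matrix.finite_real_spectrum.bddAbove hν)

lemma inner_toEuclideanLin_le_lambdaMax (hA : A.IsSymm) (x : EuclideanSpace ℝ (Fin d)) :
    ⟪x, Matrix.toEuclideanLin A x⟫ ≤ lambdaMax A * ‖x‖ ^ 2 := by
  have h := (posSemidef_lambdaMax_sub hA).re_dotProduct_nonneg (WithLp.ofLp x)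
  simp only [Matrix.sub_mulVec, dotProduct_sub, Algebra.algebraMap_eq_smul_one, Matrix.smul_mulVec,
    Matrix.one_mulVec, dotProduct_smul, star_trivial, RCLike.re_to_real, smul_eq_mul,
    sub_nonneg] at h
  rw [EuclideanSpace.inner_eq_star_dotProduct, ← real_inner_self_eq_norm_sq,
    EuclideanSpace.inner_eq_star_dotProduct, star_trivial, dotProduct_comm]
  exact h

end LambdaMax

section Norming

/-- A finite set of unit vectors that norms every vector up to a factor two: the form in which
nets of the sphere enter the union bounds. -/
def IsNorming {E : Type*} [NormedAddCommGroup E] [InnerProductSpace ℝ E] (N : Finset E) : Prop :=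
  (∀ y ∈ N, ‖y‖ = 1) ∧ ∀ w : E, ∃ y ∈ N, ‖w‖ ≤ 2 * ⟪w, y⟫

variable {E : Type*} [NormedAddCommGroup E]

lemma packingNumber_sphere_le [NormedSpace ℝ E] [FiniteDimensional ℝ E] :
    Metric.packingNumber (1 / 2) (Metric.sphere (0 : E) 1) ≤ 5 ^ Module.finrank ℝ E := by
  classical
  refine iSup_le fun C => iSup_le fun hC => iSup_le fun hsep => ?_
  by_contra! hlt
  obtain ⟨S, hSC, hS⟩ := Set.exists_subset_encard_eq (Order.add_one_le_of_lt hlt)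
  have hSfin : S.Finite := Set.finite_of_encard_eq_coe (k := 5 ^ Module.finrank ℝ E + 1)
    (by rw [hS]; push_cast; rfl)
  have hcard := Besicovitch.card_le_of_separated (hSfin.toFinset.image fun c : E => (2 : ℝ) • c)
    (fun c hc => ?_) (fun c hc e he hne => ?_)
  · rw [Finset.card_image_of_injective _ (smul_right_injective E (two_ne_zero' ℝ)),
      ← Nat.cast_le (α := ℕ∞), ← hSfin.encard_eq_coe_toFinset_card, hS] at hcard
    norm_cast at hcard
    omega
  · obtain ⟨c, hc', rfl⟩ := Finset.mem_image.1 hc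
    have hc1 : ‖c‖ = 1 := by simpa using hC (hSC (hSfin.mem_toFinset.1 hc'))
    simp [norm_smul, hc1]
  · obtain ⟨c, hc', rfl⟩ := Finset.mem_image.1 hc
    obtain ⟨e, he', rfl⟩ := Finset.mem_image.1 he
    have hce : ((1 / 2 : NNReal) : ENNReal) < edist c e :=
      hsep (hSC (hSfin.mem_toFinset.1 hc')) (hSC (hSfin.mem_toFinset.1 he'))
        fun h => hne (by rw [h])
    rw [edist_nndist, ENNReal.coe_lt_coe, ← NNReal.coe_lt_coe, coe_nndist, dist_eq_norm] at hce
    rw [← smul_sub, norm_smul, Real.norm_eq_abs, abs_two]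
    push_cast at hce
    linarith

variable [InnerProductSpace ℝ E]

lemma exists_isNorming [FiniteDimensional ℝ E] [Nontrivial E] :
    ∃ N : Finset E, IsNorming N ∧ N.card ≤ 5 ^ Module.finrank ℝ E := by
  have hpack := packingNumber_sphere_le (E := E)
  have hfin : Metric.packingNumber (1 / 2) (Metric.sphere (0 : E) 1) ≠ ⊤ :=
    ne_top_of_le_ne_top (ENat.natCast_ne_top (5 ^ Module.finrank ℝ E)) (by simpa using hpack)
  rw [← Metric.encard_maximalSeparatedSet hfin] at hpack
  set S := Metric.maximalSeparatedSet (1 / 2) (Metric.sphere (0 : E) 1)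
  have hS : S.Finite := Set.finite_of_encard_le_coe (k := 5 ^ Module.finrank ℝ E)
    (by simpa using hpack)
  have hunit : ∀ y ∈ S, ‖y‖ = 1 := fun y hy => by
    simpa using Metric.maximalSeparatedSet_subset hy
  have hnorm : ∀ u : E, ‖u‖ = 1 → ∃ y ∈ S, 1 ≤ 2 * ⟪u, y⟫ := fun u hu => by
    obtain ⟨y, hy, huy⟩ := Metric.isCover_maximalSeparatedSet hfin (show u ∈ _ by simpa using hu)
    have hdist : ‖u - y‖ ≤ 1 / 2 := by
      have h : edist u y ≤ (1 / 2 : NNReal) := huy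
      rw [edist_nndist, ENNReal.coe_le_coe, ← NNReal.coe_le_coe, coe_nndist, dist_eq_norm] at h
      simpa only [NNReal.coe_div, NNReal.coe_one, NNReal.coe_ofNat] using h
    have h := norm_sub_sq_real u y
    rw [hu, hunit y hy] at h
    exact ⟨y, hy, by nlinarith [norm_nonneg (u - y)]⟩
  refine ⟨hS.toFinset, ⟨fun y hy => hunit y (hS.mem_toFinset.1 hy), fun w => ?_⟩, ?_⟩
  · obtain ⟨u, hu, hw⟩ : ∃ u : E, ‖u‖ = 1 ∧ w = ‖w‖ • u := by
      rcases eq_or_ne w 0 with rfl | hw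
      · obtain ⟨u, hu⟩ := exists_norm_eq E zero_le_one
        exact ⟨u, hu, by simp⟩
      · exact ⟨‖w‖⁻¹ • w, norm_smul_inv_norm hw, by
          rw [smul_smul, mul_inv_cancel₀ (norm_ne_zero_iff.2 hw), one_smul]⟩
    obtain ⟨y, hy, huy⟩ := hnorm u hu
    refine ⟨y, hS.mem_toFinset.2 hy, ?_⟩
    calc ‖w‖ ≤ ‖w‖ * (2 * ⟪u, y⟫) := le_mul_of_one_le_right (norm_nonneg w) huy
      _ = 2 * ⟪‖w‖ • u, y⟫ := by rw [real_inner_smul_left]; ring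
      _ = 2 * ⟪w, y⟫ := by rw [← hw]
  · rw [← Nat.cast_le (α := ℕ∞), ← hS.encard_eq_coe_toFinset_card]
    simpa using hpack

lemma IsNorming.norm_apply_le {N : Finset E} (hN : IsNorming N) {F : E → E}
    (hF : ∀ x y, ⟪F x, y⟫ = ⟪x, F y⟫) {M : ℝ} (hM : ∀ x ∈ N, ∀ y ∈ N, ⟪F x, y⟫ ≤ M) (z : E) :
    ‖F z‖ ≤ 4 * M * ‖z‖ := by
  obtain ⟨y, hy, hFz⟩ := hN.2 (F z)
  obtain ⟨x, hx, hFy⟩ := hN.2 (F y)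
  have hFy' : ‖F y‖ ≤ 2 * M := hFy.trans (by gcongr; exact hM y hy x hx)
  calc ‖F z‖ ≤ 2 * ⟪z, F y⟫ := hF z y ▸ hFz
    _ ≤ 2 * (‖z‖ * ‖F y‖) := by gcongr; exact real_inner_le_norm z (F y)
    _ ≤ 2 * (‖z‖ * (2 * M)) := by gcongr
    _ = 4 * M * ‖z‖ := by ring

end Norming

section SubGaussian

variable {Ω : Type*} [MeasurableSpace Ω] {μ : Measure Ω}

lemma integral_eq_zero_of_hasSubgaussianMGF [IsProbabilityMeasure μ] {X : Ω → ℝ} {c : NNReal}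
    (hX : HasSubgaussianMGF X c μ) : ∫ ω, X ω ∂μ = 0 := by
  have hmin : IsLocalMin (fun t => Real.exp (c * t ^ 2 / 2) - mgf X μ t) 0 :=
    Filter.Eventually.of_forall fun t => by simpa using hX.mgf_le t
  have hexp : HasDerivAt (fun t : ℝ => Real.exp (c * t ^ 2 / 2)) 0 0 := by
    simpa using ((((hasDerivAt_pow 2 (0 : ℝ)).const_mul (c : ℝ)).div_const 2).exp)
  have hmgf := hasDerivAt_mgf (X := X) (μ := μ) (t := 0) (by simp [hX.integrableExpSet_eq_univ])
  simpa using hmin.hasDerivAt_eq_zero (hexp.sub hmgf)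

lemma hasSubgaussianMGF_mono {X : Ω → ℝ} {c c' : NNReal} (hX : HasSubgaussianMGF X c μ)
    (hc : c ≤ c') : HasSubgaussianMGF X c' μ where
  integrable_exp_mul := hX.integrable_exp_mul
  mgf_le t := (hX.mgf_le t).trans (by gcongr)

lemma lintegral_exp_sq_gaussianReal :
    ∫⁻ g, ENNReal.ofReal (Real.exp (g ^ 2 / 4)) ∂(gaussianReal 0 1) = ENNReal.ofReal √2 := by
  have hdensity (g : ℝ) : (gaussianPDF 0 1 * fun g => ENNReal.ofReal (Real.exp (g ^ 2 / 4))) g =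
      ENNReal.ofReal ((√(2 * Real.pi))⁻¹ * Real.exp (-(1 / 4) * g ^ 2)) := by
    rw [Pi.mul_apply, gaussianPDF, ← ENNReal.ofReal_mul (gaussianPDFReal_nonneg _ _ _),
      gaussianPDFReal, mul_assoc, ← Real.exp_add]
    simp only [NNReal.coe_one, mul_one, sub_zero]
    ring_nf
  rw [gaussianReal_of_var_ne_zero _ one_ne_zero, lintegral_withDensity_eq_lintegral_mul _
    (measurable_gaussianPDF 0 1) (by fun_prop)]
  simp_rw [hdensity]
  rw [← ofReal_integral_eq_lintegral_ofReal
    ((integrable_exp_neg_mul_sq (by norm_num)).const_mul _)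
    (Filter.Eventually.of_forall fun g => by positivity), integral_const_mul, integral_gaussian,
    show Real.pi / (1 / 4) = 2 * (2 * Real.pi) by ring, Real.sqrt_mul zero_le_two (2 * Real.pi),
    mul_comm √2, inv_mul_cancel_left₀ (by positivity)]

lemma exp_sq_eq_lintegral_gaussianReal (z : ℝ) : ENNReal.ofReal (Real.exp (z ^ 2 / 4)) =
    ∫⁻ g, ENNReal.ofReal (Real.exp (z / √2 * g)) ∂(gaussianReal 0 1) := by
  rw [← ofReal_integral_eq_lintegral_ofReal (integrable_exp_mul_gaussianReal _)
    (Filter.Eventually.of_forall fun g => by positivity)]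
  have hmgf := mgf_gaussianReal (p := gaussianReal 0 1) (X := id) (μ := 0) (v := 1) (by simp)
    (z / √2)
  simp only [mgf, id, div_pow, Real.sq_sqrt zero_le_two, NNReal.coe_one, zero_mul, zero_add,
    one_mul] at hmgf
  rw [hmgf]
  ring_nf

variable [IsProbabilityMeasure μ] {Z W : Ω → ℝ}

/- Linearise the square with an independent standard Gaussian `g`: `exp (z² / 4)` is the mean of
`exp (z g / √2)`, so after Fubini only the linear exponential moments of `Z` are needed. -/
lemma lintegral_exp_sq_le (hZ : HasSubgaussianMGF Z 1 μ) :
    ∫⁻ ω, ENNReal.ofReal (Real.exp (Z ω ^ 2 / 4)) ∂μ ≤ ENNReal.ofReal √2 := by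
  have hZm : AEMeasurable Z μ := hZ.aemeasurable
  simp_rw [exp_sq_eq_lintegral_gaussianReal]
  rw [lintegral_lintegral_swap (by simp only [Function.uncurry_def]; fun_prop),
    ← lintegral_exp_sq_gaussianReal]
  refine lintegral_mono fun g => ?_
  have hswap (ω : Ω) : Z ω / √2 * g = g / √2 * Z ω := by ring
  simp_rw [hswap]
  rw [← ofReal_integral_eq_lintegral_ofReal (hZ.integrable_exp_mul (g / √2))
    (Filter.Eventually.of_forall fun g => by positivity)]
  refine ENNReal.ofReal_le_ofReal ((hZ.mgf_le (g / √2)).trans_eq ?_)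
  rw [div_pow, Real.sq_sqrt zero_le_two, NNReal.coe_one]
  ring_nf

lemma integrable_exp_sq (hZ : HasSubgaussianMGF Z 1 μ) :
    Integrable (fun ω => Real.exp (Z ω ^ 2 / 4)) μ := by
  have hZm : AEMeasurable Z μ := hZ.aemeasurable
  refine ⟨AEMeasurable.aestronglyMeasurable (by fun_prop), ?_⟩
  rw [hasFiniteIntegral_iff_ofReal (Filter.Eventually.of_forall fun g => by positivity)]
  exact (lintegral_exp_sq_le hZ).trans_lt ENNReal.ofReal_lt_top

lemma integral_exp_sq_le (hZ : HasSubgaussianMGF Z 1 μ) :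
    ∫ ω, Real.exp (Z ω ^ 2 / 4) ∂μ ≤ √2 := by
  rw [integral_eq_lintegral_of_nonneg_ae (Filter.Eventually.of_forall fun g => by positivity)
    (integrable_exp_sq hZ).aestronglyMeasurable]
  exact ENNReal.toReal_le_of_le_ofReal (by positivity) (lintegral_exp_sq_le hZ)

end SubGaussian

section Subexponential

variable {Ω : Type*} [MeasurableSpace Ω] {μ : Measure Ω}

/-- A centred random variable with `ψ₁`-Orlicz norm at most `4`: the class of variables covered by
the Bernstein inequality below. -/
structure IsCenteredSubexponential (μ : Measure Ω) (U : Ω → ℝ) : Prop where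
  measurable : Measurable U
  integrable_exp_abs : Integrable (fun ω => Real.exp (|U ω| / 4)) μ
  integral_exp_abs_le : ∫ ω, Real.exp (|U ω| / 4) ∂μ ≤ 2
  integral_eq_zero : ∫ ω, U ω ∂μ = 0

lemma exp_abs_mul_sub_le {z w p : ℝ} (hp : |p| ≤ 1) :
    Real.exp (|z * w - p| / 4) ≤
      Real.exp (1 / 4) / 2 * (Real.exp (z ^ 2 / 4) + Real.exp (w ^ 2 / 4)) := by
  have hexp (x : ℝ) : Real.exp (x ^ 2 / 4) = Real.exp (x ^ 2 / 8) ^ 2 := by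
    rw [← Real.exp_nat_mul]
    push_cast
    ring_nf
  have habs : |z * w - p| / 4 ≤ 1 / 4 + (z ^ 2 / 8 + w ^ 2 / 8) := by
    have hprod := two_mul_le_add_sq |z| |w|
    have htri : |z * w - p| ≤ |z * w| + |p| := abs_sub _ _
    rw [sq_abs, sq_abs] at hprod
    rw [abs_mul] at htri
    linarith
  calc Real.exp (|z * w - p| / 4) ≤ Real.exp (1 / 4 + (z ^ 2 / 8 + w ^ 2 / 8)) := by gcongr
    _ = Real.exp (1 / 4) / 2 * (2 * Real.exp (z ^ 2 / 8) * Real.exp (w ^ 2 / 8)) := by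
      rw [Real.exp_add, Real.exp_add]
      ring
    _ ≤ _ := by
      rw [hexp, hexp]
      gcongr
      exact two_mul_le_add_sq _ _

lemma exp_one_div_four_le_sqrt_two : Real.exp (1 / 4) ≤ √2 := by
  have hpow : Real.exp (1 / 4) ^ 4 = Real.exp 1 := by
    rw [← Real.exp_nat_mul]
    norm_num
  have hsq : (Real.exp (1 / 4) ^ 2) ^ 2 ≤ 2 ^ 2 := by
    rw [← pow_mul, hpow]
    linarith [Real.exp_one_lt_d9]
  exact Real.le_sqrt_of_sq_le (le_of_sq_le_sq hsq zero_le_two)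

lemma isCenteredSubexponential_mul_sub [IsProbabilityMeasure μ] {Z W : Ω → ℝ}
    (hZm : Measurable Z) (hWm : Measurable W) (hZ : HasSubgaussianMGF Z 1 μ)
    (hW : HasSubgaussianMGF W 1 μ) (hZW : |∫ ω, Z ω * W ω ∂μ| ≤ 1) :
    IsCenteredSubexponential μ fun ω => Z ω * W ω - ∫ ω, Z ω * W ω ∂μ := by
  have hbound := ((integrable_exp_sq hZ).add (integrable_exp_sq hW)).const_mul
    (Real.exp (1 / 4) / 2)
  have hint : Integrable (fun ω => Real.exp (|Z ω * W ω - ∫ ω, Z ω * W ω ∂μ| / 4)) μ :=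
    hbound.mono' (by fun_prop) (Filter.Eventually.of_forall fun ω => by
      rw [Real.norm_of_nonneg (by positivity)]
      exact exp_abs_mul_sub_le hZW)
  refine ⟨by fun_prop, hint, ?_, ?_⟩
  · calc ∫ ω, Real.exp (|Z ω * W ω - ∫ ω, Z ω * W ω ∂μ| / 4) ∂μ
        ≤ ∫ ω, Real.exp (1 / 4) / 2 * (Real.exp (Z ω ^ 2 / 4) + Real.exp (W ω ^ 2 / 4)) ∂μ :=
          integral_mono hint hbound fun ω => exp_abs_mul_sub_le hZW
      _ = Real.exp (1 / 4) / 2 *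
          (∫ ω, Real.exp (Z ω ^ 2 / 4) ∂μ + ∫ ω, Real.exp (W ω ^ 2 / 4) ∂μ) := by
          rw [integral_const_mul, integral_add (integrable_exp_sq hZ) (integrable_exp_sq hW)]
      _ ≤ √2 / 2 * (√2 + √2) := by
          gcongr
          exacts [exp_one_div_four_le_sqrt_two, integral_exp_sq_le hZ, integral_exp_sq_le hW]
      _ = 2 := by linarith [Real.mul_self_sqrt (zero_le_two (α := ℝ))]
  · have hZ₂ : MemLp Z 2 μ := hZ.memLp 2
    have hW₂ : MemLp W 2 μ := hW.memLp 2
    have hZW₁ : Integrable (fun ω => Z ω * W ω) μ := hZ₂.integrable_mul hW₂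
    rw [integral_sub hZW₁ (integrable_const _),
      integral_const, probReal_univ, one_smul, sub_self]

lemma exp_le_one_add_add_sq_mul_exp_abs (x : ℝ) :
    Real.exp x ≤ 1 + x + x ^ 2 * Real.exp |x| := by
  have h := Complex.norm_exp_sub_sum_le_norm_mul_exp (x : ℂ) 2
  simp only [Finset.sum_range_succ, Finset.sum_range_zero, pow_zero, pow_one, Nat.factorial,
    zero_add, mul_one, Nat.cast_one, div_one, ← Complex.ofReal_exp, Complex.norm_real,
    Real.norm_eq_abs, sq_abs] at h
  have hreal : |Real.exp x - (1 + x)| ≤ x ^ 2 * Real.exp |x| := by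
    rw [← Real.norm_eq_abs, ← Complex.norm_real]
    exact_mod_cast h
  linarith [le_abs_self (Real.exp x - (1 + x))]

lemma exp_mul_le_of_abs_le {t : ℝ} (ht : |t| ≤ 1 / 8) (x : ℝ) :
    Real.exp (t * x) ≤ 1 + t * x + 128 * t ^ 2 * Real.exp (|x| / 4) := by
  have htx : |t * x| ≤ |x| / 8 := by
    rw [abs_mul]
    nlinarith [abs_nonneg x]
  have hx : x ^ 2 ≤ 128 * Real.exp (|x| / 8) := by
    have h := Real.quadratic_le_exp_of_nonneg (x := |x| / 8) (by positivity)
    nlinarith [sq_abs x, abs_nonneg x]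
  calc Real.exp (t * x) ≤ 1 + t * x + t ^ 2 * x ^ 2 * Real.exp |t * x| :=
        mul_pow t x 2 ▸ exp_le_one_add_add_sq_mul_exp_abs (t * x)
    _ ≤ 1 + t * x + t ^ 2 * (128 * Real.exp (|x| / 8)) * Real.exp (|x| / 8) := by gcongr
    _ = 1 + t * x + 128 * t ^ 2 * Real.exp (|x| / 4) := by
        rw [show |x| / 4 = |x| / 8 + |x| / 8 by ring, Real.exp_add]
        ring

lemma IsCenteredSubexponential.integrable_exp_mul {U : Ω → ℝ} (hU : IsCenteredSubexponential μ U)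
    {t : ℝ} (ht : |t| ≤ 1 / 4) : Integrable (fun ω => Real.exp (t * U ω)) μ :=
  hU.integrable_exp_abs.mono' (by have := hU.measurable; fun_prop)
    (Filter.Eventually.of_forall fun ω => by
      rw [Real.norm_of_nonneg (by positivity)]
      refine Real.exp_le_exp.2 ((le_abs_self _).trans ?_)
      rw [abs_mul]
      nlinarith [abs_nonneg (U ω)])

lemma IsCenteredSubexponential.integrable {U : Ω → ℝ} (hU : IsCenteredSubexponential μ U) :
    Integrable U μ :=
  (hU.integrable_exp_abs.const_mul 4).mono' hU.measurable.aestronglyMeasurable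
    (Filter.Eventually.of_forall fun ω => by
      rw [Real.norm_eq_abs]
      linarith [Real.add_one_le_exp (|U ω| / 4)])

lemma IsCenteredSubexponential.mgf_le [IsProbabilityMeasure μ] {U : Ω → ℝ}
    (hU : IsCenteredSubexponential μ U) {t : ℝ} (ht : |t| ≤ 1 / 8) :
    mgf U μ t ≤ Real.exp (256 * t ^ 2) := by
  have hlin : Integrable (fun ω => 1 + t * U ω) μ :=
    (integrable_const _).add (hU.integrable.const_mul t)
  have hquad := hU.integrable_exp_abs.const_mul (128 * t ^ 2)
  calc mgf U μ t
      ≤ ∫ ω, (1 + t * U ω + 128 * t ^ 2 * Real.exp (|U ω| / 4)) ∂μ :=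
        integral_mono (hU.integrable_exp_mul (ht.trans (by norm_num))) (hlin.add hquad)
          fun ω => exp_mul_le_of_abs_le ht (U ω)
    _ = 1 + 128 * t ^ 2 * ∫ ω, Real.exp (|U ω| / 4) ∂μ := by
        rw [integral_add hlin hquad, integral_add (integrable_const _) (hU.integrable.const_mul t),
          integral_const_mul, integral_const_mul, hU.integral_eq_zero, integral_const,
          probReal_univ, one_smul, mul_zero, add_zero]
    _ ≤ 1 + 128 * t ^ 2 * 2 := by gcongr; exact hU.integral_exp_abs_le
    _ = 256 * t ^ 2 + 1 := by ring
    _ ≤ Real.exp (256 * t ^ 2) := Real.add_one_le_exp _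

lemma exists_chernoff_parameter {u m : ℝ} (hu : 0 ≤ u) (hm : 0 ≤ m) :
    ∃ t : ℝ, 0 ≤ t ∧ t ≤ 1 / 8 ∧ m * t ^ 2 ≤ u / 64 ∧ u / 8 ≤ t * (√(u * m) + u) := by
  rcases le_or_gt m u with hmu | hum
  · exact ⟨1 / 8, by norm_num, le_rfl, by linarith, by linarith [Real.sqrt_nonneg (u * m)]⟩
  · have hm' : 0 < m := hu.trans_lt hum
    have hsqrt : √(u / m) * √(u * m) = u := by
      rw [← Real.sqrt_mul (by positivity), show u / m * (u * m) = u ^ 2 by field_simp,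
        Real.sqrt_sq hu]
    refine ⟨√(u / m) / 8, by positivity, ?_, ?_, ?_⟩
    · linarith [Real.sqrt_le_one.2 (div_le_one_of_le₀ hum.le hm)]
    · rw [div_pow, Real.sq_sqrt (by positivity)]
      field_simp
      norm_num
    · have : 0 ≤ √(u / m) / 8 * u := by positivity
      linarith

lemma measureReal_sum_subexponential_ge_le [IsProbabilityMeasure μ] {ι : Type*} [Fintype ι]
    {U : ι → Ω → ℝ} (hU : ∀ i, IsCenteredSubexponential μ (U i)) (hind : iIndepFun U μ)
    {u : ℝ} (hu : 0 ≤ u) :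
    μ.real {ω | 80 * (√(u * Fintype.card ι) + u) ≤ ∑ i, U i ω} ≤ Real.exp (-6 * u) := by
  obtain ⟨t, ht₀, ht₈, htsq, htu⟩ := exists_chernoff_parameter hu (Nat.cast_nonneg (Fintype.card ι))
  have habs : |t| ≤ 1 / 8 := by rwa [abs_of_nonneg ht₀]
  have hmeas (i) : Measurable (U i) := (hU i).measurable
  have hchernoff := measure_ge_le_exp_mul_mgf (80 * (√(u * Fintype.card ι) + u)) ht₀
    (hind.integrable_exp_mul_sum (s := Finset.univ) hmeas fun i _ =>
      (hU i).integrable_exp_mul (habs.trans (by norm_num)))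
  simp only [Finset.sum_apply] at hchernoff
  rw [hind.mgf_sum hmeas] at hchernoff
  calc μ.real {ω | 80 * (√(u * Fintype.card ι) + u) ≤ ∑ i, U i ω}
      ≤ Real.exp (-t * (80 * (√(u * Fintype.card ι) + u))) * ∏ i, mgf (U i) μ t := hchernoff
    _ ≤ Real.exp (-t * (80 * (√(u * Fintype.card ι) + u))) * ∏ _i : ι, Real.exp (256 * t ^ 2) := by
        gcongr with i
        · exact fun i _ => mgf_nonneg
        · exact (hU i).mgf_le habs
    _ = Real.exp (-t * (80 * (√(u * Fintype.card ι) + u)) + Fintype.card ι * (256 * t ^ 2)) := by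
        rw [Finset.prod_const, Finset.card_univ, ← Real.exp_nat_mul, Real.exp_add]
    _ ≤ Real.exp (-6 * u) := by
        gcongr
        linarith

end Subexponential

section Independence

variable {Ω : Type*} [MeasurableSpace Ω] {μ : Measure Ω}

lemma hasSubgaussianMGF_of_lintegral_le {X : Ω → ℝ} (hX : Measurable X) {c : NNReal}
    (h : ∀ t : ℝ, ∫⁻ ω, ENNReal.ofReal (Real.exp (t * X ω)) ∂μ ≤
      ENNReal.ofReal (Real.exp (c * t ^ 2 / 2))) : HasSubgaussianMGF X c μ where
  integrable_exp_mul t := by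
    refine ⟨by fun_prop, ?_⟩
    rw [hasFiniteIntegral_iff_ofReal (Filter.Eventually.of_forall fun _ => by positivity)]
    exact (h t).trans_lt ENNReal.ofReal_lt_top
  mgf_le t := by
    rw [mgf, integral_eq_lintegral_of_nonneg_ae
      (Filter.Eventually.of_forall fun _ => by positivity) (by fun_prop)]
    exact ENNReal.toReal_le_of_le_ofReal (by positivity) (h t)

lemma lintegral_comp_prodMk_of_indepFun {α β : Type*} [MeasurableSpace α] [MeasurableSpace β]
    [IsFiniteMeasure μ] {A : Ω → α} {X : Ω → β} (hA : Measurable A) (hX : Measurable X)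
    (hAX : IndepFun A X μ) {F : α × β → ENNReal} (hF : Measurable F) :
    ∫⁻ ω, F (A ω, X ω) ∂μ = ∫⁻ ω', ∫⁻ ω, F (A ω', X ω) ∂μ ∂μ := by
  rw [← lintegral_map hF (hA.prodMk hX),
    (indepFun_iff_map_prod_eq_prod_map_map hA.aemeasurable hX.aemeasurable).1 hAX,
    lintegral_prod _ hF.aemeasurable, lintegral_map hF.lintegral_prod_right' hA]
  exact lintegral_congr fun ω' => lintegral_map (hF.comp measurable_prodMk_left) hX

lemma hasSubgaussianMGF_of_indepFun {α β : Type*} [MeasurableSpace α] [MeasurableSpace β]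
    [IsProbabilityMeasure μ] {A : Ω → α} {X : Ω → β} (hA : Measurable A) (hX : Measurable X)
    (hAX : IndepFun A X μ) {F : α × β → ℝ} (hF : Measurable F) {c : NNReal}
    (h : ∀ ω', HasSubgaussianMGF (fun ω => F (A ω', X ω)) c μ) :
    HasSubgaussianMGF (fun ω => F (A ω, X ω)) c μ := by
  refine hasSubgaussianMGF_of_lintegral_le (by fun_prop) fun t => ?_
  rw [lintegral_comp_prodMk_of_indepFun hA hX hAX
    (F := fun p => ENNReal.ofReal (Real.exp (t * F p))) (by fun_prop)]
  calc ∫⁻ ω', ∫⁻ ω, ENNReal.ofReal (Real.exp (t * F (A ω', X ω))) ∂μ ∂μ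
      ≤ ∫⁻ _, ENNReal.ofReal (Real.exp (c * t ^ 2 / 2)) ∂μ := by
        refine lintegral_mono fun ω' => ?_
        rw [← ofReal_integral_eq_lintegral_ofReal ((h ω').integrable_exp_mul t)
          (Filter.Eventually.of_forall fun _ => by positivity)]
        exact ENNReal.ofReal_le_ofReal ((h ω').mgf_le t)
    _ = ENNReal.ofReal (Real.exp (c * t ^ 2 / 2)) := by simp

lemma hasSubgaussianMGF_sum_const_mul {ι : Type*} [Fintype ι] {X : ι → Ω → ℝ}
    (hind : iIndepFun X μ) {c : NNReal} (hX : ∀ i, HasSubgaussianMGF (X i) c μ) {a : ι → ℝ}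
    (ha : ∀ i, |a i| ≤ 1) :
    HasSubgaussianMGF (fun ω => ∑ i, a i * X i ω) (Fintype.card ι * c) μ := by
  have hterm (i : ι) : HasSubgaussianMGF (fun ω => a i * X i ω) c μ := by
    refine hasSubgaussianMGF_mono ((hX i).const_mul (a i)) (mul_le_of_le_one_left' ?_)
    exact sq_le_one_iff_abs_le_one (a i) |>.2 (ha i)
  simpa using HasSubgaussianMGF.sum_of_iIndepFun (s := Finset.univ)
    (hind.comp (fun i z => a i * z) fun i => by fun_prop) fun i _ => hterm i

lemma iIndepFun_comp_of_disjoint {ι κ β γ : Type*} [MeasurableSpace β] [MeasurableSpace γ]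
    {W : ι → Ω → β} (hW : iIndepFun W μ) (hm : ∀ i, Measurable (W i)) {B : κ → Finset ι}
    (hB : Pairwise fun a b => Disjoint (B a) (B b)) {g : ∀ c, (B c → β) → γ}
    (hg : ∀ c, Measurable (g c)) :
    iIndepFun (fun c ω => g c (fun j => W j ω)) μ := by
  classical
  have : IsProbabilityMeasure μ := hW.isProbabilityMeasure
  rw [iIndepFun_iff_measure_inter_preimage_eq_mul]
  intro S sets hsets
  induction S using Finset.induction_on with
  | empty => simp
  | insert a S ha ih =>
    rw [Finset.set_biInter_insert, Finset.prod_insert ha,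
      ← ih fun i hi => hsets i (Finset.mem_insert_of_mem hi)]
    have hdisj : Disjoint (B a) (S.biUnion B) :=
      (Finset.disjoint_biUnion_right _ _ _).2 fun b hb => hB (ne_of_mem_of_not_mem hb ha).symm
    have hsub {c : κ} (hc : c ∈ S) (j : B c) : (j : ι) ∈ S.biUnion B :=
      Finset.mem_biUnion.2 ⟨c, hc, j.2⟩
    let R : Set (S.biUnion B → β) :=
      ⋂ c : S, (fun x => g c fun j : B c => x ⟨j, hsub c.2 j⟩) ⁻¹' sets c
    have hR : MeasurableSet R := MeasurableSet.iInter fun c =>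
      (hg c).comp (measurable_pi_lambda _ fun j => measurable_pi_apply _)
        (hsets c (Finset.mem_insert_of_mem c.2))
    convert! (hW.indepFun_finset (B a) (S.biUnion B) hdisj hm).measure_inter_preimage_eq_mul
      (g a ⁻¹' sets a) R (hg a (hsets a (Finset.mem_insert_self a S))) hR using 2
    · congr 1
      ext ω
      simp [R]
    · congr 1
      ext ω
      simp [R]

lemma iIndepFun_comp_of_dependsOn {ι κ β γ : Type*} [MeasurableSpace β] [MeasurableSpace γ]
    {W : ι → Ω → β} (hW : iIndepFun W μ) (hm : ∀ i, Measurable (W i)) {B : κ → Finset ι}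
    (hB : Pairwise fun a b => Disjoint (B a) (B b)) {G : κ → (ι → β) → γ}
    (hG : ∀ c, Measurable (G c)) (hGB : ∀ c, DependsOn (G c) (B c)) :
    iIndepFun (fun c ω => G c (fun j => W j ω)) μ := by
  classical
  have : IsProbabilityMeasure μ := hW.isProbabilityMeasure
  obtain ⟨ω₀⟩ := nonempty_of_isProbabilityMeasure μ
  let extend (c : κ) (w : B c → β) (j : ι) : β := if h : j ∈ B c then w ⟨j, h⟩ else W j ω₀
  have hextend (c : κ) : Measurable (extend c) := by
    refine measurable_pi_lambda _ fun j => ?_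
    by_cases h : j ∈ B c <;> simp only [extend, h, dite_true, dite_false] <;> fun_prop
  have hblock := iIndepFun_comp_of_disjoint hW hm hB fun c => (hG c).comp (hextend c)
  refine (iIndepFun_congr fun c => Filter.Eventually.of_forall fun ω => ?_).1 hblock
  refine hGB c fun j hj => ?_
  simp [extend, Finset.mem_coe.1 hj]

lemma iIndepFun_of_forall_indepFun_Iio {ι β : Type*} [LinearOrder ι] [MeasurableSpace β]
    [IsProbabilityMeasure μ] {W : ι → Ω → β}
    (h : ∀ j, IndepFun (fun ω (i : Set.Iio j) => W i ω) (W j) μ) : iIndepFun W μ := by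
  rw [iIndepFun_iff_measure_inter_preimage_eq_mul]
  intro S sets hsets
  induction S using Finset.induction_on_max with
  | empty => simp
  | insert j S hj ih =>
    have hnotMem : j ∉ S := fun hjS => (hj j hjS).false
    let R : Set (Set.Iio j → β) := ⋂ i : S, (fun x => x ⟨i, hj i i.2⟩) ⁻¹' sets i
    have hR : MeasurableSet R := MeasurableSet.iInter fun i =>
      measurable_pi_apply _ (hsets i (Finset.mem_insert_of_mem i.2))
    have hpast : (fun ω (i : Set.Iio j) => W i ω) ⁻¹' R = ⋂ i ∈ S, W i ⁻¹' sets i := by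
      ext ω
      simp [R]
    rw [Finset.set_biInter_insert, Finset.prod_insert hnotMem, Set.inter_comm, ← hpast,
      (h j).measure_inter_preimage_eq_mul _ _ hR (hsets j (Finset.mem_insert_self j S)), hpast,
      ih fun i hi => hsets i (Finset.mem_insert_of_mem hi), mul_comm]

lemma five_pow_mul_exp_le (D : ℕ) (c : ℝ) :
    (5 : ℝ) ^ D * Real.exp (-(c + 2) * D) ≤ Real.exp (-c * D) := by
  have h5 : (5 : ℝ) ≤ Real.exp 2 := by
    linarith [Real.quadratic_le_exp_of_nonneg (x := 2) zero_le_two]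
  calc (5 : ℝ) ^ D * Real.exp (-(c + 2) * D)
      ≤ Real.exp 2 ^ D * Real.exp (-(c + 2) * D) := by gcongr
    _ = Real.exp (-c * D) := by
        rw [← Real.exp_nat_mul, ← Real.exp_add]
        ring_nf

lemma measureReal_exists_mem_le {β : Type*} {N : Finset β} {D : ℕ}
    (hN : N.card ≤ 5 ^ D) {A : β → Set Ω} {c : ℝ}
    (hA : ∀ x ∈ N, μ.real (A x) ≤ Real.exp (-(c + 2) * D)) :
    μ.real {ω | ∃ x ∈ N, ω ∈ A x} ≤ Real.exp (-c * D) := by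
  have hunion : {ω | ∃ x ∈ N, ω ∈ A x} = ⋃ x ∈ N, A x := by
    ext
    simp
  calc μ.real {ω | ∃ x ∈ N, ω ∈ A x} ≤ ∑ x ∈ N, μ.real (A x) :=
        hunion ▸ measureReal_biUnion_finset_le N A
    _ ≤ N.card * Real.exp (-(c + 2) * D) := by
        rw [← nsmul_eq_mul]
        exact Finset.sum_le_card_nsmul N _ _ hA
    _ ≤ 5 ^ D * Real.exp (-(c + 2) * D) := by
        gcongr
        exact_mod_cast hN
    _ ≤ Real.exp (-c * D) := five_pow_mul_exp_le D c

end Independence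

section IsotropicSubGaussian

variable {Ω : Type*} [MeasurableSpace Ω] {μ : Measure Ω} {E : Type*} [NormedAddCommGroup E]
  [InnerProductSpace ℝ E] [MeasurableSpace E]

/-- An isotropic `1`-sub-Gaussian random vector of a Euclidean space: the coordinate-free form of
the assumptions on one noise vector. -/
structure IsIsotropicSubGaussian (μ : Measure Ω) (X : Ω → E) : Prop where
  measurable : Measurable X
  hasSubgaussianMGF_inner : ∀ x : E, HasSubgaussianMGF (fun ω => ⟪x, X ω⟫) (‖x‖₊ ^ 2) μ
  integral_inner_mul_inner : ∀ x y : E, ∫ ω, ⟪x, X ω⟫ * ⟪y, X ω⟫ ∂μ = ⟪x, y⟫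

variable {ι : Type*} {X : ι → Ω → E}

section NormalizedSum

lemma integrable_inner_mul_inner {X Y : Ω → E} (hX : IsIsotropicSubGaussian μ X)
    (hY : IsIsotropicSubGaussian μ Y) (x y : E) :
    Integrable (fun ω => ⟪x, X ω⟫ * ⟪y, Y ω⟫) μ := by
  have hx : MemLp (fun ω => ⟪x, X ω⟫) 2 μ := (hX.hasSubgaussianMGF_inner x).memLp 2
  have hy : MemLp (fun ω => ⟪y, Y ω⟫) 2 μ := (hY.hasSubgaussianMGF_inner y).memLp 2
  exact hx.integrable_mul hy

variable [BorelSpace E] [SecondCountableTopology E] [IsProbabilityMeasure μ]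

lemma integral_inner_mul_inner_of_ne (hX : ∀ i, IsIsotropicSubGaussian μ (X i))
    (hind : iIndepFun X μ) {a b : ι} (hab : a ≠ b) (x y : E) :
    ∫ ω, ⟪x, X a ω⟫ * ⟪y, X b ω⟫ ∂μ = 0 := by
  have hi : IndepFun (fun ω => ⟪x, X a ω⟫) (fun ω => ⟪y, X b ω⟫) μ :=
    (hind.indepFun hab).comp (φ := fun z => ⟪x, z⟫) (ψ := fun z => ⟪y, z⟫)
      (by fun_prop) (by fun_prop)
  have hx := (hX a).hasSubgaussianMGF_inner x
  rw [hi.integral_fun_mul_eq_mul_integral hx.aestronglyMeasurable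
    ((hX b).hasSubgaussianMGF_inner y).aestronglyMeasurable,
    integral_eq_zero_of_hasSubgaussianMGF hx, zero_mul]

lemma isIsotropicSubGaussian_normalized_sum (hX : ∀ i, IsIsotropicSubGaussian μ (X i))
    (hind : iIndepFun X μ) {s : Finset ι} (hs : s.Nonempty) :
    IsIsotropicSubGaussian μ fun ω => (√(s.card : ℝ))⁻¹ • ∑ j ∈ s, X j ω := by
  have hcard : (0 : ℝ) < s.card := by exact_mod_cast hs.card_pos
  have hinner (x : E) (ω : Ω) : ⟪x, (√(s.card : ℝ))⁻¹ • ∑ j ∈ s, X j ω⟫ =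
      (√(s.card : ℝ))⁻¹ * ∑ j ∈ s, ⟪x, X j ω⟫ := by rw [real_inner_smul_right, inner_sum]
  refine ⟨?_, fun x => ?_, fun x y => ?_⟩
  · have hm (j : ι) : Measurable (X j) := (hX j).measurable
    fun_prop
  · simp_rw [hinner]
    have hsum := HasSubgaussianMGF.sum_of_iIndepFun (s := s)
      (hind.comp (fun _ z => ⟪x, z⟫) fun _ => by fun_prop)
      fun j _ => (hX j).hasSubgaussianMGF_inner x
    refine hasSubgaussianMGF_mono (hsum.const_mul _) (NNReal.coe_le_coe.1 (le_of_eq ?_))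
    change (√(s.card : ℝ))⁻¹ ^ 2 * ((∑ _ ∈ s, ‖x‖₊ ^ 2 : NNReal) : ℝ) = _
    rw [Finset.sum_const, nsmul_eq_mul, inv_pow, Real.sq_sqrt hcard.le, NNReal.coe_mul,
      NNReal.coe_natCast, inv_mul_cancel_left₀ hcard.ne']
  · have hint (a b : ι) := integrable_inner_mul_inner (hX a) (hX b) x y
    have hdiag (a : ι) (ha : a ∈ s) : ∫ ω, ∑ b ∈ s, ⟪x, X a ω⟫ * ⟪y, X b ω⟫ ∂μ = ⟪x, y⟫ := by
      rw [integral_finsetSum _ fun b _ => hint a b, Finset.sum_eq_single_of_mem a ha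
        fun b _ hb => integral_inner_mul_inner_of_ne hX hind hb.symm x y,
        (hX a).integral_inner_mul_inner]
    have hprod (ω : Ω) : ⟪x, (√(s.card : ℝ))⁻¹ • ∑ j ∈ s, X j ω⟫ *
        ⟪y, (√(s.card : ℝ))⁻¹ • ∑ j ∈ s, X j ω⟫ =
        (s.card : ℝ)⁻¹ * ∑ a ∈ s, ∑ b ∈ s, ⟪x, X a ω⟫ * ⟪y, X b ω⟫ := by
      rw [hinner, hinner, mul_mul_mul_comm, ← mul_inv, Real.mul_self_sqrt hcard.le,
        Finset.sum_mul_sum]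
    simp_rw [hprod]
    rw [integral_const_mul, integral_finsetSum _ fun a _ => integrable_finsetSum _ fun b _ =>
      hint a b, Finset.sum_congr rfl hdiag, Finset.sum_const, nsmul_eq_mul,
      inv_mul_cancel_left₀ hcard.ne']

end NormalizedSum

variable [BorelSpace E] [FiniteDimensional ℝ E] [IsProbabilityMeasure μ] [Fintype ι]

lemma hasSubgaussianMGF_inner_sum_smul (hX : ∀ i, IsIsotropicSubGaussian μ (X i))
    (hind : iIndepFun X μ) {A : ι → Ω → ℝ} (hA : ∀ i, Measurable (A i))
    (hA₁ : ∀ i ω, |A i ω| ≤ 1) (hAX : IndepFun (fun ω i => A i ω) (fun ω i => X i ω) μ) (y : E) :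
    HasSubgaussianMGF (fun ω => ⟪∑ i, A i ω • X i ω, y⟫) (Fintype.card ι * ‖y‖₊ ^ 2) μ := by
  have hm (i : ι) : Measurable (X i) := (hX i).measurable
  refine hasSubgaussianMGF_of_indepFun (A := fun ω i => A i ω) (X := fun ω i => X i ω)
    (F := fun p => ⟪∑ i, p.1 i • p.2 i, y⟫) (by fun_prop) (by fun_prop) hAX (by fun_prop)
    fun ω' => ?_
  have hinner (ω : Ω) : ⟪∑ i, A i ω' • X i ω, y⟫ = ∑ i, A i ω' * ⟪y, X i ω⟫ := by
    simp_rw [sum_inner, real_inner_smul_left, real_inner_comm y]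
  simp only [hinner]
  exact hasSubgaussianMGF_sum_const_mul (hind.comp (fun _ z => ⟪y, z⟫) fun _ => by fun_prop)
    (fun i => (hX i).hasSubgaussianMGF_inner y) fun i => hA₁ i ω'

variable [Nontrivial E]

lemma measureReal_norm_sum_smul_ge_le [Nonempty ι] (hX : ∀ i, IsIsotropicSubGaussian μ (X i))
    (hind : iIndepFun X μ) {A : ι → Ω → ℝ} (hA : ∀ i, Measurable (A i))
    (hA₁ : ∀ i ω, |A i ω| ≤ 1) (hAX : IndepFun (fun ω i => A i ω) (fun ω i => X i ω) μ) :
    μ.real {ω | 8 * √(Module.finrank ℝ E * Fintype.card ι : ℝ) ≤ ‖∑ i, A i ω • X i ω‖} ≤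
      Real.exp (-6 * Module.finrank ℝ E) := by
  obtain ⟨N, hN, hcard⟩ := exists_isNorming (E := E)
  set r := √(Module.finrank ℝ E * Fintype.card ι : ℝ) with hr
  have hdirection (y : E) (hy : y ∈ N) : μ.real {ω | 4 * r ≤ ⟪∑ i, A i ω • X i ω, y⟫} ≤
      Real.exp (-(6 + 2) * Module.finrank ℝ E) := by
    refine ((hasSubgaussianMGF_inner_sum_smul hX hind hA hA₁ hAX y).measure_ge_le
      (ε := 4 * r) (by positivity)).trans_eq ?_
    have : (0 : ℝ) < Fintype.card ι := by exact_mod_cast Fintype.card_pos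
    rw [mul_pow, hr, Real.sq_sqrt (by positivity)]
    push_cast
    rw [hN.1 y hy]
    congr 1
    field_simp
    ring
  refine (measureReal_mono fun ω hω => ?_).trans (measureReal_exists_mem_le hcard hdirection)
  obtain ⟨y, hy, hωy⟩ := hN.2 (∑ i, A i ω • X i ω)
  have hω' : 8 * r ≤ ‖∑ i, A i ω • X i ω‖ := hω
  exact ⟨y, hy, show 4 * r ≤ _ by linarith⟩

lemma measureReal_exists_norm_sum_inner_smul_sub_gt_le (hX : ∀ i, IsIsotropicSubGaussian μ (X i))
    (hind : iIndepFun X μ) :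
    μ.real {ω | ∃ z, 320 * (√(Module.finrank ℝ E * Fintype.card ι : ℝ) + Module.finrank ℝ E) * ‖z‖ <
      ‖∑ i, (⟪X i ω, z⟫ • X i ω - z)‖} ≤ Real.exp (-2 * Module.finrank ℝ E) := by
  obtain ⟨N, hN, hcard⟩ := exists_isNorming (E := E)
  set r := 80 * (√(Module.finrank ℝ E * Fintype.card ι : ℝ) + Module.finrank ℝ E) with hr
  have hpair (x : E) (hx : x ∈ N) (y : E) (hy : y ∈ N) :
      μ.real {ω | r ≤ ∑ i, (⟪x, X i ω⟫ * ⟪y, X i ω⟫ - ⟪x, y⟫)} ≤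
        Real.exp (-(4 + 2) * Module.finrank ℝ E) := by
    have hsub {w : E} (hw : w ∈ N) (i : ι) : HasSubgaussianMGF (fun ω => ⟪w, X i ω⟫) 1 μ := by
      simpa [nnnorm, hN.1 w hw] using (hX i).hasSubgaussianMGF_inner w
    have hm (i : ι) : Measurable (X i) := (hX i).measurable
    have hxy : |⟪x, y⟫| ≤ 1 := by simpa [hN.1 x hx, hN.1 y hy] using abs_real_inner_le_norm x y
    have hcent (i : ι) : IsCenteredSubexponential μ fun ω => ⟪x, X i ω⟫ * ⟪y, X i ω⟫ - ⟪x, y⟫ := by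
      rw [← (hX i).integral_inner_mul_inner] at hxy ⊢
      exact isCenteredSubexponential_mul_sub (by fun_prop) (by fun_prop) (hsub hx i) (hsub hy i) hxy
    convert measureReal_sum_subexponential_ge_le hcent
      (hind.comp (fun _ z => ⟪x, z⟫ * ⟪y, z⟫ - ⟪x, y⟫) fun _ => by fun_prop)
      (Nat.cast_nonneg (Module.finrank ℝ E)) using 2
    norm_num
  refine (measureReal_mono fun ω hω => ?_).trans (measureReal_exists_mem_le hcard fun x hx =>
    (measureReal_exists_mem_le hcard (hpair x hx)).trans_eq (by norm_num))
  obtain ⟨z, hz⟩ := hω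
  by_contra hsmall
  have hM (x : E) (hx : x ∈ N) (y : E) (hy : y ∈ N) :
      ⟪∑ i, (⟪X i ω, x⟫ • X i ω - x), y⟫ ≤ r := by
    by_contra! h
    refine hsmall ⟨x, hx, y, hy, h.le.trans_eq ?_⟩
    simp_rw [sum_inner, inner_sub_left, real_inner_smul_left, real_inner_comm x, real_inner_comm y]
  have hsymm (x y : E) :
      ⟪∑ i, (⟪X i ω, x⟫ • X i ω - x), y⟫ = ⟪x, ∑ i, (⟪X i ω, y⟫ • X i ω - y)⟫ := by
    simp_rw [sum_inner, inner_sum, inner_sub_left, inner_sub_right, real_inner_smul_left,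
      real_inner_smul_right, real_inner_comm x, mul_comm]
  refine hz.not_ge ((hN.norm_apply_le hsymm hM z).trans_eq ?_)
  rw [hr]
  ring

end IsotropicSubGaussian

section Bucket

variable {n k l : ℕ}

lemma mem_bucket {i : Fin l} {j : Fin n} :
    j ∈ bucket n k i ↔ (i : ℕ) * k ≤ (j : ℕ) ∧ (j : ℕ) < ((i : ℕ) + 1) * k := by
  simp [bucket]

lemma card_bucket (hn : n = k * l) (i : Fin l) : (bucket n k i).card = k := by
  have hi : ((i : ℕ) + 1) * k ≤ n := by
    rw [hn, mul_comm k l]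
    exact Nat.mul_le_mul_right k i.2
  have hmap : (bucket n k i).map Fin.valEmbedding =
      Finset.Ico ((i : ℕ) * k) (((i : ℕ) + 1) * k) := by
    ext j
    simp only [Finset.mem_map, mem_bucket, Fin.valEmbedding_apply, Finset.mem_Ico]
    exact ⟨fun ⟨_, ha, hj⟩ => hj ▸ ha, fun hj => ⟨⟨j, hj.2.trans_le hi⟩, hj, rfl⟩⟩
  rw [← Finset.card_map Fin.valEmbedding, hmap, Nat.card_Ico, Nat.add_mul, one_mul,
    Nat.add_sub_cancel_left]

lemma nonempty_bucket (hn : n = k * l) (hk : 1 ≤ k) (i : Fin l) : (bucket n k i).Nonempty := by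
  rw [← Finset.card_pos, card_bucket hn]
  exact hk

lemma pairwise_disjoint_bucket :
    Pairwise fun i i' : Fin l => Disjoint (bucket n k i) (bucket n k i') := by
  refine fun i i' hne => Finset.disjoint_left.2 fun j hj hj' => hne (Fin.ext ?_)
  rw [mem_bucket] at hj hj'
  have h : (i : ℕ) < i' + 1 := lt_of_mul_lt_mul_right (hj.1.trans_lt hj'.2) (Nat.zero_le k)
  have h' : (i' : ℕ) < i + 1 := lt_of_mul_lt_mul_right (hj'.1.trans_lt hj.2) (Nat.zero_le k)
  omega

lemma mem_bucket_of_mem_Ioc {i : Fin l} {a b j : Fin n} (ha : a ∈ bucket n k i)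
    (hb : b ∈ bucket n k i) (hj : j ∈ Finset.Ioc a b) : j ∈ bucket n k i := by
  rw [mem_bucket] at ha hb ⊢
  rw [Finset.mem_Ioc, Fin.lt_def, Fin.le_def] at hj
  omega

variable {E : Type*} [AddCommGroup E] [Module ℝ E]

/-- The sum over the `i`-th bucket, divided by `√k`. The normalised noise `normalizedBucketSum k ξ`
satisfies the same isotropy and sub-Gaussian assumptions as the noise `ξ`. -/
noncomputable def normalizedBucketSum (k : ℕ) (x : Fin n → E) (i : Fin l) : E :=
  (√(k : ℝ))⁻¹ • ∑ j ∈ bucket n k i, x j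

lemma bucketMean_eq_smul_normalizedBucketSum (x : Fin n → E) (i : Fin l) :
    bucketMean k x i = (√(k : ℝ))⁻¹ • normalizedBucketSum k x i := by
  rw [bucketMean, normalizedBucketSum, smul_smul, ← mul_inv, Real.mul_self_sqrt k.cast_nonneg,
    one_div]

lemma bucketMean_smul_add (a : Fin n → ℝ) (v : E) (x : Fin n → E) (i : Fin l) :
    bucketMean k (fun j => a j • v + x j) i = bucketMean k a i • v + bucketMean k x i := by
  simp only [bucketMean, Finset.sum_add_distrib, smul_add, ← Finset.sum_smul, smul_smul,
    smul_eq_mul]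

lemma bucketMean_of_forall_eq (hn : n = k * l) (hk : 1 ≤ k) {x : Fin n → ℝ} {c : ℝ}
    (hx : ∀ j, x j = c) (i : Fin l) : bucketMean k x i = c := by
  have hk₀ : (k : ℝ) ≠ 0 := by exact_mod_cast (by omega : k ≠ 0)
  simp only [bucketMean, hx, Finset.sum_const, card_bucket hn, nsmul_eq_mul, smul_eq_mul, one_div]
  exact inv_mul_cancel_left₀ hk₀ c

lemma abs_bucketMean_le (hn : n = k * l) {x : Fin n → ℝ} (hx : ∀ j, |x j| ≤ 1) (i : Fin l) :
    |bucketMean k x i| ≤ 1 := by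
  have hsum : |∑ j ∈ bucket n k i, x j| ≤ k := by
    refine (Finset.abs_sum_le_sum_abs _ _).trans ?_
    simpa [card_bucket hn] using Finset.sum_le_card_nsmul (bucket n k i) _ 1 fun j _ => hx j
  rw [bucketMean, smul_eq_mul, abs_mul, abs_of_nonneg (by positivity), one_div_mul_eq_div]
  exact div_le_one_of_le₀ hsum k.cast_nonneg

end Bucket

section Noise

variable {Ω : Type*} [MeasurableSpace Ω] {μ : Measure Ω} {d n k l : ℕ}

lemma integral_inner_mul_inner_of_isIsotropic {X : Ω → EuclideanSpace ℝ (Fin d)}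
    (hL2 : ∀ a, MemLp (fun ω => X ω a) 2 μ) (hX : IsIsotropic μ X)
    (x y : EuclideanSpace ℝ (Fin d)) : ∫ ω, ⟪x, X ω⟫ * ⟪y, X ω⟫ ∂μ = ⟪x, y⟫ := by
  have hint (a b : Fin d) : Integrable (fun ω => x a * y b * (X ω a * X ω b)) μ :=
    ((hL2 a).integrable_mul (hL2 b)).const_mul _
  have hexpand (ω : Ω) : ⟪x, X ω⟫ * ⟪y, X ω⟫ = ∑ a, ∑ b, x a * y b * (X ω a * X ω b) := by
    simp only [PiLp.inner_apply, RCLike.inner_apply, conj_trivial, Finset.sum_mul_sum]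
    exact Finset.sum_congr rfl fun a _ => Finset.sum_congr rfl fun b _ => by ring
  have hrow (a : Fin d) : ∫ ω, ∑ b, x a * y b * (X ω a * X ω b) ∂μ = x a * y a := by
    simp [integral_finsetSum _ fun b _ => hint a b, integral_const_mul, hX a]
  simp_rw [hexpand]
  rw [integral_finsetSum _ fun a _ => integrable_finsetSum _ fun b _ => hint a b]
  simp [hrow, PiLp.inner_apply, mul_comm]

lemma IsNoise.isIsotropicSubGaussian {ξ : Fin n → Ω → EuclideanSpace ℝ (Fin d)}
    (hξ : IsNoise μ ξ) (i : Fin n) : IsIsotropicSubGaussian μ (ξ i) := by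
  have hsub : ∀ x, HasSubgaussianMGF (fun ω => ⟪x, ξ i ω⟫) (‖x‖₊ ^ 2) μ := fun x =>
    ⟨fun t => by simpa [real_inner_smul_left] using (hξ.subGaussian i (t • x)).1, fun t => by
      simpa [real_inner_smul_left, norm_smul, mgf, mul_pow, mul_comm] using
        (hξ.subGaussian i (t • x)).2⟩
  refine ⟨hξ.measurable i, hsub, integral_inner_mul_inner_of_isIsotropic (fun a => ?_)
    (hξ.isotropic i)⟩
  simpa [EuclideanSpace.inner_single_left] using (hsub (EuclideanSpace.single a 1)).memLp 2

variable {E : Type*} [NormedAddCommGroup E] [InnerProductSpace ℝ E] [MeasurableSpace E]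
  [BorelSpace E] [SecondCountableTopology E] {ξ : Fin n → Ω → E}

lemma isIsotropicSubGaussian_normalizedBucketSum [IsProbabilityMeasure μ] (hn : n = k * l)
    (hk : 1 ≤ k) (hξ : ∀ j, IsIsotropicSubGaussian μ (ξ j)) (hind : iIndepFun ξ μ) (i : Fin l) :
    IsIsotropicSubGaussian μ fun ω => normalizedBucketSum k (fun j => ξ j ω) i := by
  simpa only [normalizedBucketSum, card_bucket hn] using
    isIsotropicSubGaussian_normalized_sum hξ hind (nonempty_bucket hn hk i)

lemma measurable_normalizedBucketSum (i : Fin l) :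
    Measurable fun x : Fin n → E => normalizedBucketSum k x i := by
  unfold normalizedBucketSum
  fun_prop

lemma iIndepFun_normalizedBucketSum (hξ : ∀ j, Measurable (ξ j)) (hind : iIndepFun ξ μ) :
    iIndepFun (fun (i : Fin l) ω => normalizedBucketSum k (fun j => ξ j ω) i) μ :=
  iIndepFun_comp_of_dependsOn hind hξ pairwise_disjoint_bucket measurable_normalizedBucketSum
    fun _ _ _ hxy => congrArg _ (Finset.sum_congr rfl hxy)

end Noise

section Chain

variable {Ω : Type*} [MeasurableSpace Ω] {μ : Measure Ω}

lemma measureReal_preimage_inter_eq_mul_of_singleton {β : Type*} [MeasurableSpace β]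
    [MeasurableSingletonClass β] [IsFiniteMeasure μ] {X : Ω → β} (hX : Measurable X)
    {S : Finset β} (hXS : ∀ ω, X ω ∈ S) {D : Set Ω} {c : ℝ}
    (hD : ∀ s ∈ S, μ.real (X ⁻¹' {s} ∩ D) = c * μ.real (X ⁻¹' {s})) (A : Set β) :
    μ.real (X ⁻¹' A ∩ D) = c * μ.real (X ⁻¹' A) := by
  classical
  have hA : X ⁻¹' A = X ⁻¹' ↑(S.filter (· ∈ A)) := by
    ext ω
    simp [hXS ω]
  have hmeas (s : β) : MeasurableSet (X ⁻¹' {s}) := hX (measurableSet_singleton s)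
  have hmeas' : MeasurableSet (X ⁻¹' ↑(S.filter (· ∈ A))) := hX (Finset.measurableSet _)
  rw [hA, ← measureReal_restrict_apply hmeas',
    ← sum_measureReal_preimage_singleton (μ := μ.restrict D) _ fun s _ => hmeas s,
    ← sum_measureReal_preimage_singleton (μ := μ) _ fun s _ => hmeas s, Finset.mul_sum]
  refine Finset.sum_congr rfl fun s hs => ?_
  rw [measureReal_restrict_apply (hmeas s), hD s (Finset.mem_filter.1 hs).1]

lemma indepFun_ite_of_measureReal_preimage_inter {β γ : Type*} [MeasurableSpace β]
    [MeasurableSpace γ] [IsProbabilityMeasure μ] {X : Ω → β} (hX : Measurable X) {D : Set Ω}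
    [DecidablePred (· ∈ D)] (hD : MeasurableSet D)
    (hXD : ∀ A, MeasurableSet A → μ.real (X ⁻¹' A ∩ D) = μ.real (X ⁻¹' A) * μ.real D) (a b : γ) :
    IndepFun X (fun ω => if ω ∈ D then a else b) μ := by
  have hindep : Indep (MeasurableSpace.comap X inferInstance)
      (MeasurableSpace.generateFrom {D}) μ := by
    refine IndepSets.indep hX.comap_le
      (MeasurableSpace.generateFrom_le fun _ hs => Set.mem_singleton_iff.1 hs ▸ hD)
      (@MeasurableSpace.isPiSystem_measurableSet _ (MeasurableSpace.comap X inferInstance))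
      (IsPiSystem.singleton D)
      (@MeasurableSpace.generateFrom_measurableSet _ (MeasurableSpace.comap X inferInstance)).symm
      rfl ((IndepSets_iff _ _ μ).2 ?_)
    rintro _ _ ⟨A, hA, rfl⟩ rfl
    rw [← ofReal_measureReal, hXD A hA, ENNReal.ofReal_mul measureReal_nonneg,
      ofReal_measureReal, ofReal_measureReal]
  rw [IndepFun_iff_Indep]
  refine indep_of_indep_of_le_right hindep (Measurable.comap_le ?_)
  exact Measurable.ite (MeasurableSpace.measurableSet_generateFrom rfl) measurable_const
    measurable_const

/-- A sequence of random signs which, given the past, flips with probability `δ` at each step.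
The law of the first sign is arbitrary. -/
structure IsFlipChain (μ : Measure Ω) (δ : ℝ) {n : ℕ} (η : Fin n → Ω → ℝ) : Prop where
  measurable : ∀ i, Measurable (η i)
  sign : ∀ i ω, η i ω = 1 ∨ η i ω = -1
  transition : ∀ i j : Fin n, (j : ℕ) = (i : ℕ) + 1 → ∀ s : Fin n → ℝ,
    μ.real {ω | (∀ m ≤ i, η m ω = s m) ∧ η j ω = -η i ω} =
      δ * μ.real {ω | ∀ m ≤ i, η m ω = s m}

variable {δ : ℝ} {n : ℕ} {η : Fin n → Ω → ℝ}

lemma IsSymmetricSignChain.isFlipChain (h : IsSymmetricSignChain μ δ η) : IsFlipChain μ δ η :=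
  ⟨h.measurable, h.sign, h.transition⟩

/-- The product of consecutive terms, which is `-1` where a sequence of signs flips. The index `0`
is its own predecessor in truncated subtraction, so the value there is `1` for signs. -/
noncomputable def signFlip (x : Fin n → ℝ) (j : Fin n) : ℝ :=
  x j * x ⟨j - 1, by omega⟩

lemma measurable_signFlip (j : Fin n) : Measurable fun x : Fin n → ℝ => signFlip x j := by
  unfold signFlip
  fun_prop

lemma prod_Ioc_signFlip {x : Fin n → ℝ} (hx : ∀ j, x j = 1 ∨ x j = -1) {a b : Fin n}
    (hab : a ≤ b) : ∏ j ∈ Finset.Ioc a b, signFlip x j = x a * x b := by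
  have hsq (j : Fin n) : x j * x j = 1 := mul_self_eq_one_iff.2 (hx j)
  obtain ⟨b, hb⟩ := b
  change (a : ℕ) ≤ b at hab
  revert hb
  induction b, hab using Nat.le_induction with
  | base => simp [hsq a]
  | succ b hab ih =>
    intro hb
    have hIoc : Finset.Ioc a ⟨b + 1, hb⟩ =
        insert ⟨b + 1, hb⟩ (Finset.Ioc a ⟨b, Nat.lt_of_succ_lt hb⟩) := by
      ext j
      simp only [Finset.mem_insert, Finset.mem_Ioc, Fin.lt_def, Fin.le_def, Fin.ext_iff]
      omega
    rw [hIoc, Finset.prod_insert (by simp), ih]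
    simp only [signFlip, Nat.add_sub_cancel]
    linear_combination (x a * x ⟨b + 1, hb⟩) * hsq ⟨b, Nat.lt_of_succ_lt hb⟩

namespace IsFlipChain

lemma sq_eq_one (h : IsFlipChain μ δ η) (j : Fin n) (ω : Ω) : η j ω ^ 2 = 1 :=
  (sq _).trans (mul_self_eq_one_iff.2 (h.sign j ω))

lemma abs_le_one (h : IsFlipChain μ δ η) (ω : Ω) (j : Fin n) : |η j ω| ≤ 1 :=
  (sq_le_one_iff_abs_le_one _).1 (h.sq_eq_one j ω).le

lemma measurable_past (h : IsFlipChain μ δ η) (i : Fin n) :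
    Measurable fun ω (m : Set.Iic i) => η m ω :=
  measurable_pi_lambda _ fun m => h.measurable m

lemma measureReal_past_inter_flip [IsFiniteMeasure μ] (h : IsFlipChain μ δ η) {i j : Fin n}
    (hij : (j : ℕ) = i + 1) (A : Set (Set.Iic i → ℝ)) :
    μ.real ((fun ω (m : Set.Iic i) => η m ω) ⁻¹' A ∩ {ω | η j ω = -η i ω}) =
      δ * μ.real ((fun ω (m : Set.Iic i) => η m ω) ⁻¹' A) := by
  classical
  refine measureReal_preimage_inter_eq_mul_of_singleton (h.measurable_past i)
    (S := Fintype.piFinset fun _ => {1, -1}) (fun ω => ?_) (fun s _ => ?_) A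
  · simpa [Fintype.mem_piFinset] using fun m _ => h.sign m ω
  · have hpast : (fun ω (m : Set.Iic i) => η m ω) ⁻¹' {s} =
        {ω | ∀ m ≤ i, η m ω = Function.extend Subtype.val s 0 m} := by
      ext ω
      simp only [Set.mem_preimage, Set.mem_singleton_iff, funext_iff, Subtype.forall, Set.mem_Iic,
        Set.mem_ofPred_eq]
      exact forall₂_congr fun m hm => by
        rw [← Subtype.val_injective.extend_apply s 0 ⟨m, hm⟩]
    rw [hpast]
    exact h.transition i j hij _

lemma indepFun_past_signFlip [IsProbabilityMeasure μ] (h : IsFlipChain μ δ η) {i j : Fin n}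
    (hij : (j : ℕ) = i + 1) :
    IndepFun (fun ω (m : Set.Iic i) => η m ω) (fun ω => signFlip (fun m => η m ω) j) μ := by
  classical
  have hD : MeasurableSet {ω | η j ω = -η i ω} :=
    measurableSet_eq_fun (h.measurable j) (h.measurable i).neg
  have hμD : μ.real {ω | η j ω = -η i ω} = δ := by
    simpa using h.measureReal_past_inter_flip hij Set.univ
  have hpred : (⟨j - 1, by omega⟩ : Fin n) = i := Fin.ext (by simp [hij])
  have hflip : (fun ω => signFlip (fun m => η m ω) j) =
      fun ω => if ω ∈ {ω | η j ω = -η i ω} then (-1 : ℝ) else 1 := by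
    ext ω
    rw [signFlip, hpred]
    rcases h.sign i ω with hi | hi <;> rcases h.sign j ω with hj | hj <;>
      norm_num [Set.mem_ofPred_eq, hi, hj]
  rw [hflip]
  refine indepFun_ite_of_measureReal_preimage_inter (h.measurable_past i) hD (fun A _ => ?_) _ _
  rw [h.measureReal_past_inter_flip hij A, hμD, mul_comm]

lemma iIndepFun_signFlip [IsProbabilityMeasure μ] (h : IsFlipChain μ δ η) :
    iIndepFun (fun j ω => signFlip (fun m => η m ω) j) μ := by
  refine iIndepFun_of_forall_indepFun_Iio fun j => ?_
  rcases Nat.eq_zero_or_pos j with hj | hj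
  · have hone : (fun ω => signFlip (fun m => η m ω) j) = fun _ => 1 := by
      ext ω
      have hpred : (⟨j - 1, by omega⟩ : Fin n) = j := Fin.ext (by simp [hj])
      rw [signFlip, hpred, ← sq, h.sq_eq_one]
    rw [hone]
    exact indepFun_const_right _ _
  · let i : Fin n := ⟨j - 1, by omega⟩
    have hij : (j : ℕ) = i + 1 := (Nat.sub_add_cancel hj).symm
    have hle (m : Set.Iio j) : (m : Fin n) ∈ Set.Iic i := by
      have := Fin.lt_def.1 m.2
      exact Fin.le_def.2 (by omega)
    have hle' (m : Set.Iio j) : (⟨(m : Fin n) - 1, by omega⟩ : Fin n) ∈ Set.Iic i := by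
      have := Fin.le_def.1 (hle m)
      exact Fin.le_def.2 (by simp only; omega)
    exact (h.indepFun_past_signFlip hij).comp
      (φ := fun z (m : Set.Iio j) => z ⟨m, hle m⟩ * z ⟨_, hle' m⟩) (ψ := id)
      (by fun_prop) measurable_id

variable {k l : ℕ}

lemma bucketMean_sq_eq_bucketMean_prod_signFlip_sq (h : IsFlipChain μ δ η) {i : Fin l}
    (hne : (bucket n k i).Nonempty) (ω : Ω) :
    bucketMean k (fun j => η j ω) i ^ 2 = bucketMean k (fun m =>
      ∏ j ∈ Finset.Ioc ((bucket n k i).min' hne) m, signFlip (fun j => η j ω) j) i ^ 2 := by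
  have hprod : ∀ m ∈ bucket n k i,
      ∏ j ∈ Finset.Ioc ((bucket n k i).min' hne) m, signFlip (fun j => η j ω) j =
        η ((bucket n k i).min' hne) ω * η m ω := fun m hm =>
    prod_Ioc_signFlip (fun j => h.sign j ω) (Finset.min'_le _ m hm)
  rw [bucketMean, bucketMean, Finset.sum_congr rfl hprod, ← Finset.mul_sum]
  simp only [smul_eq_mul, mul_pow, h.sq_eq_one, one_mul]

lemma iIndepFun_bucketMean_sq [IsProbabilityMeasure μ] (h : IsFlipChain μ δ η) (hn : n = k * l)
    (hk : 1 ≤ k) : iIndepFun (fun (i : Fin l) ω => bucketMean k (fun j => η j ω) i ^ 2) μ := by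
  simp only [fun i : Fin l =>
    h.bucketMean_sq_eq_bucketMean_prod_signFlip_sq (nonempty_bucket hn hk i)]
  refine iIndepFun_comp_of_dependsOn (B := bucket n k) (G := fun i x => bucketMean k (fun m =>
      ∏ j ∈ Finset.Ioc ((bucket n k i).min' (nonempty_bucket hn hk i)) m, x j) i ^ 2)
    h.iIndepFun_signFlip (fun j => ?_) pairwise_disjoint_bucket (fun i => ?_)
    fun i x y hxy => ?_
  · exact (measurable_signFlip j).comp (measurable_pi_lambda _ h.measurable)
  · unfold bucketMean
    fun_prop
  · simp only [bucketMean]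
    refine congrArg (fun s => ((1 / (k : ℝ)) • s) ^ 2) (Finset.sum_congr rfl fun m hm => ?_)
    exact Finset.prod_congr rfl fun j hj =>
      hxy j (mem_bucket_of_mem_Ioc (Finset.min'_mem _ _) hm hj)

lemma measurable_bucketMean (h : IsFlipChain μ δ η) (i : Fin l) :
    Measurable fun ω => bucketMean k (fun j => η j ω) i := by
  have := h.measurable
  unfold bucketMean
  fun_prop

lemma bucketMean_sq_mem_Icc (h : IsFlipChain μ δ η) (hn : n = k * l) (i : Fin l) (ω : Ω) :
    bucketMean k (fun j => η j ω) i ^ 2 ∈ Set.Icc (0 : ℝ) 1 :=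
  ⟨sq_nonneg _, (sq_le_one_iff_abs_le_one _).2 (abs_bucketMean_le hn (h.abs_le_one ω) i)⟩

lemma integrable_bucketMean_sq [IsFiniteMeasure μ] (h : IsFlipChain μ δ η) (hn : n = k * l)
    (i : Fin l) : Integrable (fun ω => bucketMean k (fun j => η j ω) i ^ 2) μ :=
  Integrable.of_mem_Icc 0 1 ((h.measurable_bucketMean i).pow_const 2).aemeasurable
    (ae_of_all _ (h.bucketMean_sq_mem_Icc hn i))

lemma hasSubgaussianMGF_energy_sub [IsProbabilityMeasure μ] (h : IsFlipChain μ δ η)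
    (hn : n = k * l) (hk : 1 ≤ k) :
    HasSubgaussianMGF (fun ω => ∑ i : Fin l, bucketMean k (fun j => η j ω) i ^ 2 -
      expectedEnergy μ k l η) (l / 4) μ := by
  have hsub (i : Fin l) : HasSubgaussianMGF (fun ω => bucketMean k (fun j => η j ω) i ^ 2 -
      ∫ ω, bucketMean k (fun j => η j ω) i ^ 2 ∂μ) (1 / 4) μ := by
    convert hasSubgaussianMGF_of_mem_Icc (μ := μ)
      ((h.measurable_bucketMean i).pow_const 2).aemeasurable
      (ae_of_all _ (h.bucketMean_sq_mem_Icc hn i)) using 1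
    norm_num
  have hind := (h.iIndepFun_bucketMean_sq hn hk).comp
    (fun (i : Fin l) z => z - ∫ ω, bucketMean k (fun j => η j ω) i ^ 2 ∂μ) fun _ => by fun_prop
  convert HasSubgaussianMGF.sum_of_iIndepFun (s := Finset.univ) hind fun i _ => hsub i using 1
  · ext ω
    rw [expectedEnergy, integral_finsetSum _ fun i _ => h.integrable_bucketMean_sq hn i,
      ← Finset.sum_sub_distrib]
    rfl
  · simp [div_eq_mul_inv]

lemma measureReal_sqrt_le_abs_energy_sub_le [IsProbabilityMeasure μ] (h : IsFlipChain μ δ η)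
    (hn : n = k * l) (hk : 1 ≤ k) (hl : 1 ≤ l) (d : ℕ) :
    μ.real {ω | √((d : ℝ) * l) ≤ |∑ i : Fin l, bucketMean k (fun j => η j ω) i ^ 2 -
      expectedEnergy μ k l η|} ≤ 2 * Real.exp (-2 * d) := by
  have hl₀ : (l : ℝ) ≠ 0 := by exact_mod_cast (by omega : l ≠ 0)
  have hexp : -√((d : ℝ) * l) ^ 2 / (2 * ((l / 4 : NNReal) : ℝ)) = -2 * d := by
    rw [Real.sq_sqrt (by positivity)]
    push_cast
    field_simp
    norm_num
  have hsub := h.hasSubgaussianMGF_energy_sub hn hk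
  have hright := hsub.measure_ge_le (Real.sqrt_nonneg ((d : ℝ) * l))
  have hleft := hsub.neg.measure_ge_le (Real.sqrt_nonneg ((d : ℝ) * l))
  rw [hexp] at hright hleft
  simp only [le_abs, two_mul]
  exact (measureReal_union_le _ _).trans (add_le_add hright hleft)

lemma measureReal_forall_eq_pos [IsProbabilityMeasure μ] (h : IsFlipChain μ δ η) (hδ : δ < 1)
    (i : Fin n) : 0 < μ.real {ω | ∀ m ≤ i, η m ω = η ⟨0, i.pos⟩ ω} := by
  obtain ⟨r, hr⟩ := i
  induction r with
  | zero =>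
    have huniv : {ω | ∀ m ≤ ⟨0, hr⟩, η m ω = η ⟨0, hr⟩ ω} = Set.univ :=
      Set.eq_univ_of_forall fun ω m hm => congrArg (η · ω) (Fin.ext (Nat.le_zero.1 hm))
    rw [huniv, probReal_univ]
    exact one_pos
  | succ r ih =>
    have hr' : r < n := by omega
    have hflip := h.measureReal_past_inter_flip (i := ⟨r, hr'⟩) (j := ⟨r + 1, hr⟩) rfl
      {z | ∀ m, z m = z ⟨⟨0, by omega⟩, Nat.zero_le r⟩}
    have hpast : (fun ω (m : Set.Iic (⟨r, hr'⟩ : Fin n)) => η m ω) ⁻¹'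
        {z | ∀ m, z m = z ⟨⟨0, by omega⟩, Nat.zero_le r⟩} =
        {ω | ∀ m ≤ ⟨r, hr'⟩, η m ω = η ⟨0, by omega⟩ ω} := by
      ext ω
      simp
    rw [hpast] at hflip
    have hD : MeasurableSet {ω | η ⟨r + 1, hr⟩ ω = -η ⟨r, hr'⟩ ω} :=
      measurableSet_eq_fun (h.measurable _) (h.measurable _).neg
    refine (mul_pos (sub_pos.2 hδ) (ih hr')).trans_le ?_
    rw [sub_mul, one_mul, ← hflip, ← measureReal_sdiff_add_inter hD, add_sub_cancel_right]
    refine measureReal_mono (fun ω ⟨hω, hωD⟩ m hm => ?_) (by finiteness)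
    rcases (Fin.le_def.1 hm).eq_or_lt with hm | hm
    · obtain rfl : m = ⟨r + 1, hr⟩ := Fin.ext hm
      rw [← hω ⟨r, hr'⟩ le_rfl]
      rcases h.sign ⟨r, hr'⟩ ω with hi | hi <;> rcases h.sign ⟨r + 1, hr⟩ ω with hj | hj <;>
        simp_all
    · exact hω m (Nat.lt_succ_iff.1 hm)

lemma expectedEnergy_pos [IsProbabilityMeasure μ] (h : IsFlipChain μ δ η) (hδ : δ < 1)
    (hn : n = k * l) (hk : 1 ≤ k) (hl : 1 ≤ l) : 0 < expectedEnergy μ k l η := by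
  have hn₀ : 0 < n := hn ▸ Nat.mul_pos hk hl
  rw [expectedEnergy, integral_pos_iff_support_of_nonneg
    (fun ω => Finset.sum_nonneg fun i _ => sq_nonneg _)
    (integrable_finsetSum _ fun i _ => h.integrable_bucketMean_sq hn i)]
  have hpos := h.measureReal_forall_eq_pos hδ ⟨n - 1, by omega⟩
  refine (ENNReal.toReal_pos_iff.1 hpos).1.trans_le (measure_mono fun ω hω => ?_)
  have hconst (j : Fin n) : η j ω = η ⟨0, hn₀⟩ ω := hω j (Fin.le_def.2 (by simp only; omega))
  simp [bucketMean_of_forall_eq hn hk hconst, h.sq_eq_one, Nat.one_le_iff_ne_zero.1 hl]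

lemma sum_bucketMean_one_sq (h : IsFlipChain μ δ η) (ω : Ω) :
    ∑ i : Fin n, bucketMean 1 (fun j => η j ω) i ^ 2 = n := by
  have hsq (i : Fin n) : bucketMean 1 (fun j => η j ω) i ^ 2 = 1 := by
    obtain ⟨j, hj⟩ := Finset.card_eq_one.1 (card_bucket (one_mul n).symm i)
    simp [bucketMean, hj, h.sq_eq_one]
  simp [hsq]

lemma expectedEnergy_one [IsProbabilityMeasure μ] (h : IsFlipChain μ δ η) :
    expectedEnergy μ 1 n η = n := by
  simp [expectedEnergy, h.sum_bucketMean_one_sq]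

end IsFlipChain
end Chain

section Estimator

variable {d n k l : ℕ}

lemma isSymm_sampleCov (y : Fin n → EuclideanSpace ℝ (Fin d)) : (sampleCov k l y).IsSymm := by
  simp [Matrix.IsSymm, sampleCov, Matrix.transpose_smul, Matrix.transpose_mul]

lemma toEuclideanLin_sampleCov (y : Fin n → EuclideanSpace ℝ (Fin d))
    (x : EuclideanSpace ℝ (Fin d)) :
    Matrix.toEuclideanLin (sampleCov k l y) x =
      (1 / (l : ℝ)) • ∑ i : Fin l, ⟪bucketMean k y i, x⟫ • bucketMean k y i := by
  ext a
  have hinner (i : Fin l) : ⟪bucketMean k y i, x⟫ = ∑ b, bucketMean k y i b * x b := by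
    simp [PiLp.inner_apply, mul_comm]
  simp only [Matrix.toLpLin_apply, sampleCov, Matrix.smul_mulVec, bucketMatrix, PiLp.smul_apply,
    Pi.smul_apply, hinner, WithLp.ofLp_sum, Finset.sum_apply, WithLp.ofLp_smul,
    ← Matrix.mulVec_mulVec, Matrix.mulVec, dotProduct, Matrix.of_apply, Matrix.transpose_apply,
    smul_eq_mul, mul_comm (bucketMean k y _ a)]

section SecondMoment

variable {ι E : Type*} [Fintype ι] [NormedAddCommGroup E] [InnerProductSpace ℝ E]

lemma sum_inner_smul_signal_add_noise_sub_eq (θ : E) (b : ι → ℝ) (Z : ι → E) (m r : ℝ) (x : E) :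
    ∑ i, (⟪b i • θ + r • Z i, x⟫ • (b i • θ + r • Z i) - r ^ 2 • x) - (m * ⟪θ, x⟫) • θ =
      ((∑ i, b i ^ 2 - m) * ⟪θ, x⟫) • θ + (r * ⟪θ, x⟫) • ∑ i, b i • Z i +
        (r * ⟪∑ i, b i • Z i, x⟫) • θ + r ^ 2 • ∑ i, (⟪Z i, x⟫ • Z i - x) := by
  have hterm (i : ι) : ⟪b i • θ + r • Z i, x⟫ • (b i • θ + r • Z i) - r ^ 2 • x =
      (b i ^ 2 * ⟪θ, x⟫) • θ + (r * ⟪θ, x⟫) • b i • Z i + (r * ⟪b i • Z i, x⟫) • θ +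
        r ^ 2 • (⟪Z i, x⟫ • Z i - x) := by
    simp only [inner_add_left, real_inner_smul_left]
    module
  simp only [hterm, Finset.sum_add_distrib, ← Finset.sum_smul, ← Finset.smul_sum,
    ← Finset.mul_sum, ← Finset.sum_mul, sum_inner]
  module

lemma norm_sum_inner_smul_signal_add_noise_sub_le {θ : E} {b : ι → ℝ} {Z : ι → E}
    {m r D G K : ℝ} (hr : 0 ≤ r) (hD : |∑ i, b i ^ 2 - m| ≤ D) (hG : ‖∑ i, b i • Z i‖ ≤ G) {x : E}
    (hK : ‖∑ i, (⟪Z i, x⟫ • Z i - x)‖ ≤ K * ‖x‖) :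
    ‖∑ i, (⟪b i • θ + r • Z i, x⟫ • (b i • θ + r • Z i) - r ^ 2 • x) - (m * ⟪θ, x⟫) • θ‖ ≤
      (D * ‖θ‖ ^ 2 + 2 * r * ‖θ‖ * G + r ^ 2 * K) * ‖x‖ := by
  have hD₀ : 0 ≤ D := (abs_nonneg _).trans hD
  have hθx : |⟪θ, x⟫| ≤ ‖θ‖ * ‖x‖ := abs_real_inner_le_norm θ x
  have hGx : |⟪∑ i, b i • Z i, x⟫| ≤ G * ‖x‖ := (abs_real_inner_le_norm _ x).trans (by gcongr)
  rw [sum_inner_smul_signal_add_noise_sub_eq]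
  calc
    _ ≤ _ := norm_add₄_le
    _ ≤ D * (‖θ‖ * ‖x‖) * ‖θ‖ + r * (‖θ‖ * ‖x‖) * G + r * (G * ‖x‖) * ‖θ‖ +
        r ^ 2 * (K * ‖x‖) := by
      simp only [norm_smul, Real.norm_eq_abs, abs_mul, abs_of_nonneg hr,
        abs_of_nonneg (sq_nonneg r)]
      gcongr
    _ = _ := by ring

end SecondMoment

lemma norm_sampleCov_sub_le {y : Fin n → EuclideanSpace ℝ (Fin d)} {θ : EuclideanSpace ℝ (Fin d)}
    {b : Fin l → ℝ} {Z : Fin l → EuclideanSpace ℝ (Fin d)}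
    (hy : ∀ i, bucketMean k y i = b i • θ + (√(k : ℝ))⁻¹ • Z i) (hl : 1 ≤ l) {m D G K : ℝ}
    (hD : |∑ i, b i ^ 2 - m| ≤ D) (hG : ‖∑ i, b i • Z i‖ ≤ G) {x : EuclideanSpace ℝ (Fin d)}
    (hK : ‖∑ i, (⟪Z i, x⟫ • Z i - x)‖ ≤ K * ‖x‖) :
    ‖Matrix.toEuclideanLin (sampleCov k l y) x - (1 / (k : ℝ)) • x - (m / l * ⟪θ, x⟫) • θ‖ ≤
      1 / l * (D * ‖θ‖ ^ 2 + 2 * (√(k : ℝ))⁻¹ * ‖θ‖ * G + 1 / k * K) * ‖x‖ := by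
  have hl₀ : (l : ℝ) ≠ 0 := by exact_mod_cast (by omega : l ≠ 0)
  have hr : (√(k : ℝ))⁻¹ ^ 2 = 1 / k := by rw [inv_pow, Real.sq_sqrt k.cast_nonneg, one_div]
  have hscale : Matrix.toEuclideanLin (sampleCov k l y) x - (1 / (k : ℝ)) • x -
      (m / l * ⟪θ, x⟫) • θ = (1 / (l : ℝ)) • (∑ i, (⟪b i • θ + (√(k : ℝ))⁻¹ • Z i, x⟫ •
        (b i • θ + (√(k : ℝ))⁻¹ • Z i) - (√(k : ℝ))⁻¹ ^ 2 • x) - (m * ⟪θ, x⟫) • θ) := by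
    simp only [toEuclideanLin_sampleCov, hy, hr, Finset.sum_sub_distrib, Finset.sum_const,
      Finset.card_univ, Fintype.card_fin, ← Nat.cast_smul_eq_nsmul ℝ]
    match_scalars <;> field_simp
  rw [hscale, norm_smul, Real.norm_of_nonneg (by positivity), mul_assoc, ← hr]
  gcongr
  exact norm_sum_inner_smul_signal_add_noise_sub_le (by positivity) hD hG hK

lemma loss_thetaHat_le {θ : EuclideanSpace ℝ (Fin d)} (hθ : θ ≠ 0) {m ε : ℝ} (hm : 0 < m)
    (hl : 1 ≤ l) {vmax : Matrix (Fin d) (Fin d) ℝ → EuclideanSpace ℝ (Fin d)}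
    (hv : IsTopEigenvectorMap vmax) {y : Fin n → EuclideanSpace ℝ (Fin d)}
    (hε : ∀ x, ‖Matrix.toEuclideanLin (sampleCov k l y) x - (1 / (k : ℝ)) • x -
      (m / l * ⟪θ, x⟫) • θ‖ ≤ ε * ‖x‖) :
    loss (thetaHat vmax k l m y) θ ≤ 10 * ε / (m / l * ‖θ‖) := by
  have : (0 : ℝ) < l := by exact_mod_cast hl
  have hθ₀ : 0 < ‖θ‖ := norm_pos_iff.2 hθ
  have hsymm := isSymm_sampleCov (k := k) (l := l) y
  obtain ⟨hv₁, hv₂⟩ := hv _ hsymm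
  rw [loss, thetaHat, ← one_div_div]
  refine min_norm_sub_norm_add_le (by positivity) hθ hv₁ ?_ ?_
  · simpa only [hv₂, ← sub_smul, hv₁, mul_one] using hε (vmax (sampleCov k l y))
  · have hray := inner_toEuclideanLin_le_lambdaMax hsymm θ
    have hdev := (abs_real_inner_le_norm θ _).trans
      (mul_le_mul_of_nonneg_left (hε θ) (norm_nonneg θ))
    rw [inner_sub_right, inner_sub_right, real_inner_smul_right, real_inner_smul_right,
      real_inner_self_eq_norm_sq] at hdev
    refine le_of_mul_le_mul_right ?_ (pow_pos hθ₀ 2)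
    linarith [(abs_le.1 hdev).1]

end Estimator

section Risk

section RegularNoise

variable {ι E : Type*} [Fintype ι] [NormedAddCommGroup E] [InnerProductSpace ℝ E]

/-- The deterministic conditions on noise vectors `Z i` observed with signal weights `b i` under
which the spectral estimator is accurate: the cross terms and the deviation of the empirical
covariance of `Z` from the identity have their typical sizes. -/
structure IsRegularNoise (b : ι → ℝ) (Z : ι → E) : Prop where
  norm_sum_smul_le : ‖∑ i, b i • Z i‖ ≤ 8 * √(Module.finrank ℝ E * Fintype.card ι : ℝ)
  norm_sum_inner_smul_sub_le : ∀ x, ‖∑ i, (⟪Z i, x⟫ • Z i - x)‖ ≤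
    320 * (√(Module.finrank ℝ E * Fintype.card ι : ℝ) + Module.finrank ℝ E) * ‖x‖

variable [MeasurableSpace E] [BorelSpace E] [FiniteDimensional ℝ E] [Nontrivial E]
  {Ω : Type*} [MeasurableSpace Ω] {μ : Measure Ω} [IsProbabilityMeasure μ]

lemma measureReal_not_isRegularNoise_le [Nonempty ι] {b : ι → Ω → ℝ} {Z : ι → Ω → E}
    (hZ : ∀ i, IsIsotropicSubGaussian μ (Z i)) (hind : iIndepFun Z μ)
    (hb : ∀ i, Measurable (b i)) (hb₁ : ∀ i ω, |b i ω| ≤ 1)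
    (hbZ : IndepFun (fun ω i => b i ω) (fun ω i => Z i ω) μ) :
    μ.real {ω | ¬ IsRegularNoise (b · ω) (Z · ω)} ≤ 2 * Real.exp (-2 * Module.finrank ℝ E) := by
  have hcross := measureReal_norm_sum_smul_ge_le hZ hind hb hb₁ hbZ
  have hcov := measureReal_exists_norm_sum_inner_smul_sub_gt_le hZ hind
  have hexp : Real.exp (-6 * Module.finrank ℝ E) ≤ Real.exp (-2 * Module.finrank ℝ E) := by
    gcongr
    norm_num
  rw [two_mul]
  refine (measureReal_mono (fun ω hω => ?_) (by finiteness)).trans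
    ((measureReal_union_le _ _).trans (add_le_add (hcross.trans hexp) hcov))
  by_contra hω'
  simp only [Set.mem_union, Set.mem_ofPred_eq, not_or, not_exists, not_le, not_lt] at hω'
  exact hω ⟨hω'.1.le, hω'.2⟩

end RegularNoise

variable {d n k l : ℕ}

lemma loss_rate_eq (hk : 1 ≤ k) (hl : 1 ≤ l) (hn : n = k * l) {t : ℝ} (ht : 0 < t) (m D : ℝ) :
    10 * (1 / l * (D * t ^ 2 + 2 * (√(k : ℝ))⁻¹ * t * (8 * √((d : ℝ) * l)) +
        1 / k * (320 * (√((d : ℝ) * l) + d)))) / (m / l * t) =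
      10 * (l / m * (D / l * t + 16 * √((d : ℝ) / n) +
        320 * (1 / t * (√((d : ℝ) / (k * n)) + (d : ℝ) / n)))) := by
  have hl₀ : (0 : ℝ) < l := by exact_mod_cast hl
  have hk₀ : (0 : ℝ) < k := by exact_mod_cast hk
  have hn₀ : (n : ℝ) = k * l := by exact_mod_cast hn
  have hcross : √((d : ℝ) / n) = (√(k : ℝ))⁻¹ * √((d : ℝ) * l) / l := by
    rw [hn₀, show (d : ℝ) / (k * l) = d * l / (k * l ^ 2) by field_simp,
      Real.sqrt_div (by positivity), Real.sqrt_mul hk₀.le, Real.sqrt_sq hl₀.le]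
    field_simp
  have hcov : √((d : ℝ) / (k * n)) = 1 / k * √((d : ℝ) * l) / l := by
    rw [hn₀, show (d : ℝ) / (k * (k * l)) = d * l / (k * l) ^ 2 by field_simp,
      Real.sqrt_div (by positivity), Real.sqrt_sq (by positivity)]
    field_simp
  rw [hcross, hcov, hn₀]
  rcases eq_or_ne m 0 with rfl | hm
  · simp
  field_simp
  ring

variable {θ : EuclideanSpace ℝ (Fin d)}
  {vmax : Matrix (Fin d) (Fin d) ℝ → EuclideanSpace ℝ (Fin d)}

lemma loss_thetaHat_le_of_isRegularNoise (hk : 1 ≤ k) (hl : 1 ≤ l) (hn : n = k * l) (hθ : θ ≠ 0)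
    (hv : IsTopEigenvectorMap vmax) {a : Fin n → ℝ} {x : Fin n → EuclideanSpace ℝ (Fin d)}
    {m D : ℝ} (hm : 0 < m) (hD : |∑ i : Fin l, bucketMean k a i ^ 2 - m| ≤ D)
    (hreg : IsRegularNoise (ι := Fin l) (bucketMean k a) (normalizedBucketSum k x)) :
    loss (thetaHat vmax k l m fun j => a j • θ + x j) θ ≤
      10 * (l / m * (D / l * ‖θ‖ + 16 * √((d : ℝ) / n) +
        320 * (1 / ‖θ‖ * (√((d : ℝ) / (k * n)) + (d : ℝ) / n)))) := by
  obtain ⟨hcross, hcov⟩ := hreg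
  rw [finrank_euclideanSpace_fin, Fintype.card_fin] at hcross hcov
  rw [← loss_rate_eq hk hl hn (norm_pos_iff.2 hθ)]
  refine loss_thetaHat_le hθ hm hl hv fun z => norm_sampleCov_sub_le (fun i => ?_) hl hD hcross
    (hcov z)
  rw [bucketMean_smul_add, bucketMean_eq_smul_normalizedBucketSum x]

variable {Ω : Type*} [MeasurableSpace Ω] {μ : Measure Ω} [IsProbabilityMeasure μ] {δ : ℝ}
  {η : Fin n → Ω → ℝ} {ξ : Fin n → Ω → EuclideanSpace ℝ (Fin d)}

lemma measureReal_not_isRegularNoise_bucket_le (hk : 1 ≤ k) (hl : 1 ≤ l) (hn : n = k * l)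
    (hθ : θ ≠ 0) (hη : IsFlipChain μ δ η) (hξ : ∀ j, IsIsotropicSubGaussian μ (ξ j))
    (hind : iIndepFun ξ μ) (hηξ : IndepFun (fun ω j => η j ω) (fun ω j => ξ j ω) μ) :
    μ.real {ω | ¬ IsRegularNoise (ι := Fin l) (bucketMean k (η · ω))
      (normalizedBucketSum k (ξ · ω))} ≤ 2 * Real.exp (-2 * d) := by
  have : Nonempty (Fin l) := ⟨⟨0, hl⟩⟩
  have : Nontrivial (EuclideanSpace ℝ (Fin d)) := ⟨θ, 0, hθ⟩
  have hbucket := hηξ.comp (φ := fun z (i : Fin l) => bucketMean k z i)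
    (ψ := fun z (i : Fin l) => normalizedBucketSum k z i) (by unfold bucketMean; fun_prop)
    (measurable_pi_lambda _ measurable_normalizedBucketSum)
  simpa only [finrank_euclideanSpace_fin] using measureReal_not_isRegularNoise_le
    (isIsotropicSubGaussian_normalizedBucketSum hn hk hξ hind)
    (iIndepFun_normalizedBucketSum (fun j => (hξ j).measurable) hind) hη.measurable_bucketMean
    (fun i ω => abs_bucketMean_le hn (hη.abs_le_one ω) i) hbucket

lemma measureReal_not_loss_thetaHat_le_le (hk : 1 ≤ k) (hl : 1 ≤ l) (hn : n = k * l)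
    (hδ : δ < 1) (hθ : θ ≠ 0) (hη : IsFlipChain μ δ η) (hξ : ∀ j, IsIsotropicSubGaussian μ (ξ j))
    (hind : iIndepFun ξ μ) (hηξ : IndepFun (fun ω j => η j ω) (fun ω j => ξ j ω) μ)
    (hv : IsTopEigenvectorMap vmax) :
    μ.real {ω | ¬ loss (thetaHat vmax k l (expectedEnergy μ k l η)
        fun j => η j ω • θ + ξ j ω) θ ≤
      3360 * (l / expectedEnergy μ k l η * (√((d : ℝ) / l) * ‖θ‖ + √((d : ℝ) / n) +
        1 / ‖θ‖ * (√((d : ℝ) / (k * n)) + (d : ℝ) / n)))} ≤ 4 * Real.exp (-2 * d) := by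
  have hm := hη.expectedEnergy_pos hδ hn hk hl
  have hl₀ : (0 : ℝ) < l := by exact_mod_cast hl
  have hrate : √((d : ℝ) * l) / l = √((d : ℝ) / l) := by
    rw [show (d : ℝ) / l = d * l / l ^ 2 by field_simp, Real.sqrt_div (by positivity),
      Real.sqrt_sq hl₀.le]
  have hfail := (measureReal_union_le _ _).trans (add_le_add
    (hη.measureReal_sqrt_le_abs_energy_sub_le hn hk hl d)
    (measureReal_not_isRegularNoise_bucket_le hk hl hn hθ hη hξ hind hηξ))
  refine (measureReal_mono (fun ω hω => ?_) (by finiteness)).trans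
    (hfail.trans_eq (by ring))
  by_contra hgood
  simp only [Set.mem_union, Set.mem_ofPred_eq, not_or, not_le, not_not] at hgood
  refine hω ((loss_thetaHat_le_of_isRegularNoise hk hl hn hθ hv hm hgood.1.le hgood.2).trans ?_)
  rw [hrate, mul_left_comm, mul_left_comm (3360 : ℝ)]
  refine mul_le_mul_of_nonneg_left ?_ (by positivity)
  have hsignal : 0 ≤ √((d : ℝ) / l) * ‖θ‖ := by positivity
  have hcross := Real.sqrt_nonneg ((d : ℝ) / n)
  have hcov : 0 ≤ 1 / ‖θ‖ * (√((d : ℝ) / (k * n)) + (d : ℝ) / n) := by positivity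
  linarith

lemma measureReal_not_loss_thetaHat_one_le_le (hn : 1 ≤ n) (hθ : 1 ≤ ‖θ‖ ^ 2)
    (hη : IsFlipChain μ δ η) (hξ : ∀ j, IsIsotropicSubGaussian μ (ξ j)) (hind : iIndepFun ξ μ)
    (hηξ : IndepFun (fun ω j => η j ω) (fun ω j => ξ j ω) μ) (hv : IsTopEigenvectorMap vmax) :
    μ.real {ω | ¬ loss (thetaHat vmax 1 n (expectedEnergy μ 1 n η)
        fun j => η j ω • θ + ξ j ω) θ ≤
      3360 * (√((d : ℝ) / n) + (d : ℝ) / n)} ≤ 4 * Real.exp (-2 * d) := by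
  have hn₀ : (0 : ℝ) < n := by exact_mod_cast hn
  have hθ₁ : 1 ≤ ‖θ‖ := (one_le_sq_iff₀ (norm_nonneg θ)).1 hθ
  have hθ₀ : θ ≠ 0 := norm_pos_iff.1 (one_pos.trans_le hθ₁)
  refine (measureReal_mono (fun ω hω => ?_) (by finiteness)).trans
    ((measureReal_not_isRegularNoise_bucket_le le_rfl hn (one_mul n).symm hθ₀ hη hξ hind hηξ).trans
      (by gcongr; norm_num))
  refine fun hreg => hω ?_
  have henergy : |∑ i : Fin n, bucketMean 1 (η · ω) i ^ 2 - n| ≤ 0 := by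
    rw [hη.sum_bucketMean_one_sq, sub_self, abs_zero]
  rw [hη.expectedEnergy_one]
  refine (loss_thetaHat_le_of_isRegularNoise le_rfl hn (one_mul n).symm hθ₀ hv hn₀ henergy
    hreg).trans ?_
  rw [div_self hn₀.ne', one_mul, zero_div, zero_mul, zero_add, Nat.cast_one, one_mul]
  have hcov : 1 / ‖θ‖ * (√((d : ℝ) / n) + (d : ℝ) / n) ≤ √((d : ℝ) / n) + (d : ℝ) / n :=
    mul_le_of_le_one_left (by positivity) (by simpa using inv_le_one_of_one_le₀ hθ₁)
  have hdim : 0 ≤ (d : ℝ) / n := by positivity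
  linarith

end Risk

end HiddenMarkovMixture

open HiddenMarkovMixture in
theorem theorem1_general :
    ∃ c₀ c₁ C : ℝ, 0 < c₀ ∧ 0 < c₁ ∧ 0 < C ∧
      ∀ (d n k l : ℕ), 1 ≤ k → 1 ≤ l → n = k * l → ∀ δ : ℝ, δ < 1 →
      ∀ (Ω : Type*) [MeasurableSpace Ω] (μ : Measure Ω) [IsProbabilityMeasure μ]
        (θ : EuclideanSpace ℝ (Fin d)) (η : Fin n → Ω → ℝ)
        (ξ : Fin n → Ω → EuclideanSpace ℝ (Fin d)),
        IsFlipChain μ δ η → (∀ j, IsIsotropicSubGaussian μ (ξ j)) → iIndepFun ξ μ →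
        IndepFun (fun ω j => η j ω) (fun ω j => ξ j ω) μ →
      ∀ vmax : Matrix (Fin d) (Fin d) ℝ → EuclideanSpace ℝ (Fin d), IsTopEigenvectorMap vmax →
        (θ ≠ 0 →
          μ.real {ω | ¬ loss (thetaHat vmax k l (expectedEnergy μ k l η)
              fun j => η j ω • θ + ξ j ω) θ ≤
            C * ((l : ℝ) / expectedEnergy μ k l η *
              (√((d : ℝ) / l) * ‖θ‖ + √((d : ℝ) / n) +
                1 / ‖θ‖ * (√((d : ℝ) / (k * n)) + (d : ℝ) / n)))} ≤
            c₁ * Real.exp (-c₀ * d)) ∧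
        (1 ≤ ‖θ‖ ^ 2 → l = n →
          μ.real {ω | ¬ loss (thetaHat vmax k l (expectedEnergy μ k l η)
              fun j => η j ω • θ + ξ j ω) θ ≤
            C * (√((d : ℝ) / n) + (d : ℝ) / n)} ≤
            c₁ * Real.exp (-c₀ * d)) := by
  refine ⟨2, 4, 3360, two_pos, four_pos, by norm_num, ?_⟩
  intro d n k l hk hl hn δ hδ Ω _ μ _ θ η ξ hη hξ hind hηξ vmax hv
  refine ⟨fun hθ => measureReal_not_loss_thetaHat_le_le hk hl hn hδ hθ hη hξ hind hηξ hv,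
    fun hθ hln => ?_⟩
  subst hln
  obtain rfl : k = 1 := Nat.eq_of_mul_eq_mul_right hl (hn.symm.trans (one_mul l).symm)
  exact measureReal_not_loss_thetaHat_one_le_le hl hθ hη hξ hind hηξ hv

theorem theorem1 :
    ∃ c₀ c₁ C : ℝ, 0 < c₀ ∧ 0 < c₁ ∧ 0 < C ∧
      ∀ (d n k l : ℕ), 1 ≤ d → 1 ≤ k → 1 ≤ l → n = k * l →
      ∀ δ : ℝ, 0 < δ → δ < 1 / 2 →
      ∀ (Ω : Type*) [MeasurableSpace Ω] (μ : Measure Ω) [IsProbabilityMeasure μ]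
        (θ : EuclideanSpace ℝ (Fin d)) (η : Fin n → Ω → ℝ)
        (ξ Y : Fin n → Ω → EuclideanSpace ℝ (Fin d)),
        HiddenMarkovMixture.IsModel μ δ θ η ξ Y →
      ∀ vmax : Matrix (Fin d) (Fin d) ℝ → EuclideanSpace ℝ (Fin d),
        HiddenMarkovMixture.IsTopEigenvectorMap vmax →
        -- the case of a weak signal: any number of buckets
        (θ ≠ 0 → ‖θ‖ ^ 2 ≤ 1 →
          μ.real {ω | ¬ HiddenMarkovMixture.loss
              (HiddenMarkovMixture.thetaHat vmax k l
                (HiddenMarkovMixture.expectedEnergy μ k l η) (fun i => Y i ω)) θ ≤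
            C * ((l : ℝ) / HiddenMarkovMixture.expectedEnergy μ k l η *
              (√((d : ℝ) / l) * ‖θ‖ + √((d : ℝ) / n) +
                1 / ‖θ‖ * (√((d : ℝ) / (k * n)) + (d : ℝ) / n)))} ≤
            c₁ * Real.exp (-c₀ * d)) ∧
        -- the case of a strong signal: as many buckets as observations
        (1 ≤ ‖θ‖ ^ 2 → l = n →
          μ.real {ω | ¬ HiddenMarkovMixture.loss
              (HiddenMarkovMixture.thetaHat vmax k l
                (HiddenMarkovMixture.expectedEnergy μ k l η) (fun i => Y i ω)) θ ≤
            C * (√((d : ℝ) / n) + (d : ℝ) / n)} ≤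
            c₁ * Real.exp (-c₀ * d)) := by
  obtain ⟨c₀, c₁, C, hc₀, hc₁, hC, hgen⟩ := theorem1_general
  refine ⟨c₀, c₁, C, hc₀, hc₁, hC, fun d n k l _ hk hl hn δ _ hδ Ω _ μ _ θ η ξ Y h vmax hv => ?_⟩
  simp only [h.obs]
  have hrisk := hgen d n k l hk hl hn δ (by linarith) Ω μ θ η ξ h.chain.isFlipChain
    h.noise.isIsotropicSubGaussian h.noise.indep h.indep vmax hv
  exact ⟨fun hθ _ => hrisk.1 hθ, hrisk.2⟩
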